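/- Let $n\ge 2$, let $f$ be a holomorphic function on an open neighborhood $W$ of $\mathbf 0$ in $\mathbb C^{n+1}$ with $f(\mathbf 0)=0$ and with an isolated critical point at $\mathbf 0$. For a holomorphic function $\varphi$ write $$\overline{\mathbf{grad}}\,\varphi(\mathbf z)=\Bigl(\overline{\tfrac{\partial \varphi}{\partial z_1}(\mathbf z)},\dots,\overline{\tfrac{\partial \varphi}{\partial z_{n+1}}(\mathbf z)}\Bigr),$$ and for $\varepsilon>0$ let $S^{2n+1}_\varepsilon$ be the sphere of radius $\varepsilon$ centered at $\mathbf 0$ in $\mathbb C^{n+1}$. Then there is $\varepsilon_0>0$, depending only on $f$ and $W$, such that the closed ball of radius $\varepsilon_0$ about $\mathbf 0$ is contained in $W$ and for every $0<\varepsilon<\varepsilon_0$ the following holds. The link $K_f=f^{-1}(0)\cap S^{2n+1}_\varepsilon$ is a $C^\infty$ embedded submanifold of $\mathbb C^{n+1}=\mathbb R^{2n+2}$ of dimension $2n-1$; and for every open neighborhood $U$ of $\mathbf 0$ with $K_f\subset U$ and every holomorphic $g:U\to\mathbb C$, letting $h=g|_{K_f}:K_f\to\mathbb C=\mathbb R^2$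 and letting $S(h)$ be the set of points of $K_f$ at which the differential of $h$ has real rank less than $\min\{2n-1,2\}=2$, a point $\mathbf z_0\in K_f$ belongs to $S(h)$ if and only if the three vectors $\overline{\mathbf{grad}}\,f(\mathbf z_0)$, $\overline{\mathbf{grad}}\,g(\mathbf z_0)$ and $\mathbf z_0$ of $\mathbb C^{n+1}$ are linearly dependent over $\mathbb C$. In particular, if $n=2$, then $$S(h)=\Bigl\{\mathbf z\in K_f \;\Big|\; \det\begin{pmatrix}{}^T\overline{\mathbf{grad}}\,f(\mathbf z) & {}^T\overline{\mathbf{grad}}\,g(\mathbf z) & {}^T\mathbf z\end{pmatrix}=0\Bigr\}.$$ -/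

import Mathlib

open scoped ContDiff ComplexConjugate

noncomputable section

/-- The conjugated complex gradient of `f` at `z`: the vector whose `j`-th coordinate is the
complex conjugate of the complex partial derivative `∂f/∂z_j (z)`. -/
def conjGrad {m : ℕ} (f : EuclideanSpace ℂ (Fin m) → ℂ) (z : EuclideanSpace ℂ (Fin m)) :
    EuclideanSpace ℂ (Fin m) :=
  WithLp.toLp 2 fun j => conj (fderiv ℂ f z (EuclideanSpace.single j 1))

/-- `p` is a critical point of the holomorphic function `f`, and some punctured neighbourhood
of `p` contains no critical point of `f`. -/
def HasIsolatedCriticalPoint {m : ℕ} (f : EuclideanSpace ℂ (Fin m) → ℂ)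
    (p : EuclideanSpace ℂ (Fin m)) : Prop :=
  fderiv ℂ f p = 0 ∧ ∀ᶠ z in nhdsWithin p {p}ᶜ, fderiv ℂ f z ≠ 0

/-- The intersection of the zero set of `f` with the sphere of radius `ε` about the origin. -/
def link {m : ℕ} (f : EuclideanSpace ℂ (Fin m) → ℂ) (ε : ℝ) : Set (EuclideanSpace ℂ (Fin m)) :=
  f ⁻¹' {0} ∩ Metric.sphere 0 ε

section Submanifold

variable {E F : Type*} [NormedAddCommGroup E] [NormedSpace ℝ E]
  [NormedAddCommGroup F] [NormedSpace ℝ F]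

/-- A local parametrization of the subset `K` of `E` by an open subset of `ℝ^d`: a homeomorphism
from an open subset of `ℝ^d` onto a relatively open subset of `K` which, as a map into `E`,
is a `C^∞` immersion. -/
structure IsLocalParametrization {d : ℕ} {K : Set E}
    (e : OpenPartialHomeomorph (EuclideanSpace ℝ (Fin d)) K) : Prop where
  contDiffOn : ContDiffOn ℝ ∞ (fun x => (e x : E)) e.source
  injective_fderiv : ∀ x ∈ e.source, Function.Injective (fderiv ℝ (fun y => (e y : E)) x)

/-- `K` is an embedded `C^∞` submanifold of `E` of dimension `d` (without boundary). -/
def IsSmoothSubmanifold (d : ℕ) (K : Set E) : Prop :=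
  ∀ p : K, ∃ e : OpenPartialHomeomorph (EuclideanSpace ℝ (Fin d)) K,
    IsLocalParametrization e ∧ p ∈ e.target

/-- The set `S(h)` of singular points of a smooth map `h : K → F` on a `d`-dimensional embedded
submanifold `K`: the points at which the differential of `h`, computed in a local parametrization
of `K`, has rank less than `min (dim K) (dim F)`. -/
def singularSet (d : ℕ) {K : Set E} (h : K → F) : Set K :=
  {p | ∃ e : OpenPartialHomeomorph (EuclideanSpace ℝ (Fin d)) K,
    IsLocalParametrization e ∧ p ∈ e.target ∧
      Module.finrank ℝ (fderiv ℝ (fun x => h (e x)) (e.symm p)).range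
        < min d (Module.finrank ℝ F)}

end Submanifold

end

/-! Complex derivatives are Hermitian products: `df(v) = ⟨a, v⟩` and `dg(v) = ⟨b, v⟩`, where `a` and
`b` are the conjugated gradients. If `a` and `z` are independent over `ℂ` along the link, then `(f,
‖·‖²)` is a submersion there. The link is then a manifold whose tangent space is `⟨a, v⟩ = 0`, `re
⟨z, v⟩ = 0`. On that space `dg` has rank less than 2 exactly when `⟨b, ·⟩` fails to be onto `ℂ`, and
duality (`forall_exists_inner_eq_iff`) identifies this with dependence of `a, b, z`.

The deep point is transversality (`eventually_ne_smul_conjGrad`): near the origin no `z ≠ 0` with `f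
z = 0` is a multiple of `a`. It is proved by differential algebra instead of curve selection. If
such points accumulate at the origin, an ultrafilter of them tends to it. Map it by `z ↦ (z, conj
z)` into the complexification, where `‖z‖²` becomes the holomorphic function `∑ xᵢ yᵢ`. The
functions `f(x)` and `conj f(conj y)` vanish along the ultrafilter. Hence a holomorphic field
preserving the ideal of functions vanishing along it annihilates both, and by proportionality it
also annihilates `∑ xᵢ yᵢ`. A quotient annihilated by all such fields is constant along the
ultrafilter (`constantsTrivialAlong_ultrafilter`), so `‖z‖²` equals its limit 0, a contradiction.

The constancy theorem is an induction on dimension. If only the zero germ vanishes along the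
ultrafilter, constant fields suffice. Otherwise Weierstrass division makes the last coordinate
integral over functions of the others. Derivations lift through this extension after clearing a
denominator, and constants of an algebraic extension are algebraic over constants of the base, hence
complex numbers. Weierstrass division itself is the inversion of a holomorphic family of operators,
equal to the identity at the origin, on the Banach algebra of bounded holomorphic functions on the
disc. -/

/-! ### Holomorphy of Banach-valued maps tested by functionals. -/

section WeakHolomorphy

open Metric Filter Topology

variable {E B ι : Type*} [NormedAddCommGroup E] [NormedSpace ℂ E]
  [NormedAddCommGroup B] [NormedSpace ℂ B]

/-- Quadratic Taylor estimate and Cauchy estimate for a bounded holomorphic function. -/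
theorem norm_taylor_two_le {φ : E → ℂ} {x₀ : E} {r M : ℝ} (hr : 0 < r)
    (hM : ∀ x ∈ ball x₀ r, ‖φ x‖ ≤ M) (hd : DifferentiableOn ℂ φ (ball x₀ r)) (v : E) :
    ‖fderiv ℂ φ x₀ v‖ ≤ 2 * M / r * ‖v‖ ∧
      (‖v‖ < r → ‖φ (x₀ + v) - φ x₀ - fderiv ℂ φ x₀ v‖ ≤ 4 * M / r ^ 2 * ‖v‖ ^ 2) := by
  rcases eq_or_ne v 0 with rfl | hv
  · simp
  have hvp : 0 < ‖v‖ := norm_pos_iff.2 hv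
  set R := r / ‖v‖ with hR
  have hRp : 0 < R := div_pos hr hvp
  have hmem : ∀ ζ : ℂ, ζ ∈ ball (0 : ℂ) R → x₀ + ζ • v ∈ ball x₀ r := by
    intro ζ hζ
    rw [mem_ball_zero_iff, hR, lt_div_iff₀ hvp] at hζ
    rw [mem_ball_iff_norm, add_sub_cancel_left, norm_smul]
    exact hζ
  set h : ℂ → ℂ := fun ζ => φ (x₀ + ζ • v) with hh
  have hhd : DifferentiableOn ℂ h (ball 0 R) := by
    refine hd.comp (f := fun ζ : ℂ => x₀ + ζ • v) ?_ hmem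
    fun_prop
  have hderiv : deriv h 0 = fderiv ℂ φ x₀ v := by
    have h1 : HasFDerivAt φ (fderiv ℂ φ x₀) (x₀ + (0 : ℂ) • v) := by
      simpa using (hd.differentiableAt (ball_mem_nhds x₀ hr)).hasFDerivAt
    have h2 : HasDerivAt (fun ζ : ℂ => x₀ + ζ • v) v 0 := by
      simpa using ((hasDerivAt_id (0 : ℂ)).smul_const v).const_add x₀
    exact (h1.comp_hasDerivAt (0 : ℂ) h2).deriv
  have hmaps : Set.MapsTo h (ball 0 R) (closedBall (h 0) (2 * M)) := by
    intro ζ hζ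
    rw [mem_closedBall, dist_eq_norm]
    calc ‖h ζ - h 0‖ ≤ ‖h ζ‖ + ‖h 0‖ := norm_sub_le _ _
      _ ≤ M + M := add_le_add (hM _ (hmem _ hζ)) (hM _ (hmem _ (mem_ball_self hRp)))
      _ = 2 * M := by ring
  -- The Schwarz lemma bounds the difference quotient of the slice `h`, which is the Cauchy
  -- estimate. Applied once more to that quotient and read at `ζ = 1`, it gives the quadratic
  -- remainder.
  have hk : ∀ ζ ∈ ball (0 : ℂ) R, ‖dslope h 0 ζ‖ ≤ 2 * M / R := fun ζ hζ =>
    Complex.norm_dslope_le_div_of_mapsTo_ball hhd hmaps hζ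
  have hk0 := hk 0 (mem_ball_self hRp)
  rw [dslope_same, hderiv] at hk0
  refine ⟨hk0.trans (le_of_eq (by rw [hR]; field_simp)), fun hvr => ?_⟩
  have hkd : DifferentiableOn ℂ (dslope h 0) (ball 0 R) :=
    (Complex.differentiableOn_dslope (ball_mem_nhds _ hRp)).2 hhd
  have hkmaps : Set.MapsTo (dslope h 0) (ball 0 R) (closedBall (dslope h 0 0) (4 * M / R)) := by
    intro ζ hζ
    rw [mem_closedBall, dist_eq_norm]
    calc ‖dslope h 0 ζ - dslope h 0 0‖ ≤ ‖dslope h 0 ζ‖ + ‖dslope h 0 0‖ := norm_sub_le _ _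
      _ ≤ 2 * M / R + 2 * M / R := add_le_add (hk _ hζ) (hk _ (mem_ball_self hRp))
      _ = 4 * M / R := by ring
  have h1 : (1 : ℂ) ∈ ball (0 : ℂ) R := by
    rw [mem_ball_zero_iff, norm_one, hR, lt_div_iff₀ hvp, one_mul]; exact hvr
  have := Complex.dist_le_div_mul_dist_of_mapsTo_ball hkd hkmaps h1
  rw [dslope_same, hderiv, dslope_of_ne _ one_ne_zero, slope_def_field, dist_eq_norm,
    dist_eq_norm] at this
  simp only [sub_zero, div_one, norm_one, mul_one, hh, one_smul, zero_smul, add_zero] at this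
  refine this.trans (le_of_eq ?_)
  rw [hR]; field_simp

/-- A locally bounded map into a Banach space which is holomorphic when tested against a norming
family of functionals is holomorphic. -/
theorem differentiableAt_of_norming [CompleteSpace B] (ev : ι → B →L[ℂ] ℂ)
    (hev : ∀ b C, 0 ≤ C → (∀ i, ‖ev i b‖ ≤ C) → ‖b‖ ≤ C)
    {Φ : E → B} {x₀ : E} {r M : ℝ} (hr : 0 < r)
    (hM : ∀ i, ∀ x ∈ ball x₀ r, ‖ev i (Φ x)‖ ≤ M)
    (hd : ∀ i, DifferentiableOn ℂ (fun x => ev i (Φ x)) (ball x₀ r)) :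
    DifferentiableAt ℂ Φ x₀ := by
  classical
  rcases isEmpty_or_nonempty ι with hι | ⟨⟨i₀⟩⟩
  · have h0 : ∀ b : B, b = 0 := fun b => norm_le_zero_iff.1 (hev b 0 le_rfl fun i => hι.elim i)
    have : Φ = fun _ => 0 := funext fun x => h0 _
    rw [this]; exact differentiableAt_const _
  have hM0 : 0 ≤ M := (norm_nonneg _).trans (hM i₀ x₀ (mem_ball_self hr))
  have hsep : ∀ b c : B, (∀ i, ev i b = ev i c) → b = c := fun b c h => by
    rw [← sub_eq_zero]
    exact norm_le_zero_iff.1 (hev _ 0 le_rfl fun i => by simp [h i])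
  let l : ι → E →L[ℂ] ℂ := fun i => fderiv ℂ (fun x => ev i (Φ x)) x₀
  have T := fun i v => norm_taylor_two_le hr (hM i) (hd i) v
  set K : ℝ := 4 * M / r ^ 2 with hK
  have hK0 : 0 ≤ K := by positivity
  -- The scalar derivatives `l i v` must come from one vector of `B`. The Taylor bound does not
  -- depend on `i`, so the difference quotients along `v` are Cauchy in the norm of `B`, and their
  -- limit is that vector.
  have key : ∀ v : E, ∃ b : B, ∀ i, ev i b = l i v := by
    intro v
    obtain ⟨c, hc, hcr⟩ : ∃ c : ℝ, 0 < c ∧ c * ‖v‖ < r := by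
      refine ⟨r / (‖v‖ + 1), by positivity, ?_⟩
      rw [div_mul_eq_mul_div, div_lt_iff₀ (by positivity)]
      nlinarith [norm_nonneg v]
    let s : ℕ → ℝ := fun n => c / ((n : ℝ) + 1)
    have hs : ∀ n, 0 < s n := fun n => by positivity
    have hsc : ∀ n, s n ≤ c := fun n => div_le_self hc.le (by linarith [n.cast_nonneg (α := ℝ)])
    have hs0 : Tendsto s atTop (𝓝 0) := by
      have := (tendsto_one_div_add_atTop_nhds_zero_nat (𝕜 := ℝ)).const_mul c
      simpa [s, div_eq_mul_inv] using this
    have hsanti : ∀ N n, N ≤ n → s n ≤ s N := fun N n h => by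
      have : (N : ℝ) ≤ n := by exact_mod_cast h
      exact div_le_div_of_nonneg_left hc.le (by positivity) (by linarith)
    let q : ℕ → B := fun n => ((s n : ℝ) : ℂ)⁻¹ • (Φ (x₀ + ((s n : ℝ) : ℂ) • v) - Φ x₀)
    have hq : ∀ n i, ‖ev i (q n) - l i v‖ ≤ s n * (K * ‖v‖ ^ 2) := by
      intro n i
      have hsn : ‖((s n : ℝ) : ℂ)‖ = s n := by
        rw [Complex.norm_real, Real.norm_of_nonneg (hs n).le]
      have hne : ((s n : ℝ) : ℂ) ≠ 0 := by exact_mod_cast (hs n).ne'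
      have hlt : ‖((s n : ℝ) : ℂ) • v‖ < r := by
        rw [norm_smul, hsn]
        exact (mul_le_mul_of_nonneg_right (hsc n) (norm_nonneg v)).trans_lt hcr
      have := (T i (((s n : ℝ) : ℂ) • v)).2 hlt
      rw [norm_smul, hsn] at this
      have heq : ev i (q n) - l i v = ((s n : ℝ) : ℂ)⁻¹ * (ev i (Φ (x₀ + ((s n : ℝ) : ℂ) • v)) -
          ev i (Φ x₀) - fderiv ℂ (fun x => ev i (Φ x)) x₀ (((s n : ℝ) : ℂ) • v)) := by
        simp only [q, l, map_smul, map_sub, smul_eq_mul]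
        field_simp
      rw [heq, norm_mul, norm_inv, hsn, inv_mul_le_iff₀ (hs n)]
      refine this.trans (le_of_eq ?_)
      ring
    have hcau : CauchySeq q := by
      refine cauchySeq_of_le_tendsto_0 (fun N => 2 * (s N * (K * ‖v‖ ^ 2))) ?_ ?_
      · intro n m N hn hm
        rw [dist_eq_norm]
        refine hev _ _ (by have := (hs N).le; positivity) fun i => ?_
        have e : ev i (q n - q m) = (ev i (q n) - l i v) - (ev i (q m) - l i v) := by
          rw [map_sub]; ring
        rw [e]
        refine (norm_sub_le _ _).trans ?_
        have hn' := mul_le_mul_of_nonneg_right (hsanti N n hn) (by positivity : 0 ≤ K * ‖v‖ ^ 2)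
        have hm' := mul_le_mul_of_nonneg_right (hsanti N m hm) (by positivity : 0 ≤ K * ‖v‖ ^ 2)
        linarith [hq n i, hq m i]
      · simpa using (hs0.mul_const (K * ‖v‖ ^ 2)).const_mul 2
    obtain ⟨b, hb⟩ := cauchySeq_tendsto_of_complete hcau
    refine ⟨b, fun i => ?_⟩
    have h1 : Tendsto (fun n => ev i (q n)) atTop (𝓝 (ev i b)) :=
      ((ev i).continuous.tendsto b).comp hb
    refine tendsto_nhds_unique h1 ?_
    rw [tendsto_iff_norm_sub_tendsto_zero]
    refine squeeze_zero (fun n => norm_nonneg _) (fun n => hq n i) ?_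
    simpa using hs0.mul_const (K * ‖v‖ ^ 2)
  choose L hL using key
  let L' : E →L[ℂ] B := LinearMap.mkContinuous
    { toFun := L
      map_add' := fun v w => hsep _ _ fun i => by simp [hL]
      map_smul' := fun c v => hsep _ _ fun i => by simp [hL] } (2 * M / r) fun v =>
    hev _ _ (by positivity) fun i => by
      change ‖ev i (L v)‖ ≤ _
      rw [hL]; exact (T i v).1
  have hL' : ∀ i v, ev i (L' v) = l i v := fun i v => hL v i
  have hO : (fun x => Φ x - Φ x₀ - L' (x - x₀)) =O[𝓝 x₀] fun x => ‖x - x₀‖ ^ 2 := by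
    refine Asymptotics.IsBigO.of_bound K ?_
    filter_upwards [ball_mem_nhds x₀ hr] with x hx
    rw [Real.norm_of_nonneg (by positivity)]
    refine hev _ _ (by positivity) fun i => ?_
    have := (T i (x - x₀)).2 (mem_ball_iff_norm.1 hx)
    rw [add_sub_cancel] at this
    simpa [hL'] using this
  have ho : (fun x => Φ x - Φ x₀ - L' (x - x₀)) =o[𝓝 x₀] fun x => x - x₀ :=
    hO.trans_isLittleO <| by
      have := (Asymptotics.isLittleO_pow_sub_sub x₀ (m := 2) (by norm_num))
      exact this
  exact (HasFDerivAt.of_isLittleO ho).differentiableAt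

end WeakHolomorphy

/-! ### Bounded holomorphic functions on the disc and the backward shift. -/

section DiscAlgebra

open Metric Filter Topology

/-- The algebra of bounded holomorphic functions on the open unit disc. -/
def discAlgebra : Subalgebra ℂ (BoundedContinuousFunction (ball (0 : ℂ) 1) ℂ) where
  carrier := {φ | ∃ h : ℂ → ℂ, DifferentiableOn ℂ h (ball 0 1) ∧ ∀ z : ball (0 : ℂ) 1, φ z = h z}
  mul_mem' := by
    rintro a b ⟨h, hd, hh⟩ ⟨k, kd, hk⟩
    exact ⟨fun z => h z * k z, hd.mul kd, fun z => by simp [hh, hk]⟩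
  add_mem' := by
    rintro a b ⟨h, hd, hh⟩ ⟨k, kd, hk⟩
    exact ⟨fun z => h z + k z, hd.add kd, fun z => by simp [hh, hk]⟩
  algebraMap_mem' := fun r => ⟨fun _ => r, differentiableOn_const _, fun _ => rfl⟩

namespace discAlgebra

theorem isClosed : IsClosed (discAlgebra : Set (BoundedContinuousFunction (ball (0 : ℂ) 1) ℂ)) := by
  classical
  refine IsSeqClosed.isClosed fun a φ ha hφ => ?_
  choose h hd hh using ha
  refine ⟨fun z => if hz : z ∈ ball (0 : ℂ) 1 then φ ⟨z, hz⟩ else 0, ?_, fun z => by simp [z.2]⟩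
  have hu : TendstoUniformlyOn h (fun z => if hz : z ∈ ball (0 : ℂ) 1 then φ ⟨z, hz⟩ else 0) atTop
      (ball (0 : ℂ) 1) := by
    rw [Metric.tendstoUniformlyOn_iff]
    intro ε hε
    filter_upwards [Metric.tendsto_nhds.1 hφ ε hε] with n hn z hz
    have := (BoundedContinuousFunction.dist_coe_le_dist (⟨z, hz⟩ : ball (0 : ℂ) 1)).trans_lt hn
    rw [dist_comm]
    simpa [hz, ← hh n ⟨z, hz⟩] using this
  exact hu.tendstoLocallyUniformlyOn.differentiableOn (Eventually.of_forall hd) isOpen_ball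

instance : CompleteSpace discAlgebra := isClosed.completeSpace_coe

/-- Evaluation at a point of the open unit disc. -/
noncomputable def ev (z : ball (0 : ℂ) 1) : discAlgebra →L[ℂ] ℂ :=
  (BoundedContinuousFunction.evalCLM ℂ z).comp discAlgebra.toSubmodule.subtypeL

theorem ev_mul (z : ball (0 : ℂ) 1) (a b : discAlgebra) : ev z (a * b) = ev z a * ev z b := rfl

theorem ev_one (z : ball (0 : ℂ) 1) : ev z 1 = 1 := rfl

theorem ev_pow (z : ball (0 : ℂ) 1) (a : discAlgebra) (k : ℕ) : ev z (a ^ k) = ev z a ^ k := by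
  induction k with
  | zero => simp [ev_one]
  | succ k ih => rw [pow_succ, pow_succ, ev_mul, ih]

theorem norm_le_of_ev (b : discAlgebra) (C : ℝ) (hC : 0 ≤ C) (h : ∀ z, ‖ev z b‖ ≤ C) : ‖b‖ ≤ C :=
  (BoundedContinuousFunction.norm_le hC).2 h

theorem norm_ev_le (z : ball (0 : ℂ) 1) (b : discAlgebra) : ‖ev z b‖ ≤ ‖b‖ :=
  BoundedContinuousFunction.norm_coe_le_norm b.1 z

theorem ext_ev {b c : discAlgebra} (h : ∀ z, ev z b = ev z c) : b = c :=
  Subtype.ext (BoundedContinuousFunction.ext h)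

theorem exists_of_bounded {h : ℂ → ℂ} {M : ℝ} (hd : DifferentiableOn ℂ h (ball 0 1))
    (hM : ∀ z ∈ ball (0 : ℂ) 1, ‖h z‖ ≤ M) : ∃ b : discAlgebra, ∀ z, ev z b = h z :=
  ⟨⟨BoundedContinuousFunction.ofNormedAddCommGroup (fun z : ball (0 : ℂ) 1 => h z)
    (hd.continuousOn.domRestrict) M fun z => hM z z.2, h, hd, fun _ => rfl⟩, fun _ => rfl⟩

theorem exists_extension (b : discAlgebra) :
    ∃ h : ℂ → ℂ, DifferentiableOn ℂ h (ball 0 1) ∧ ∀ z, ev z b = h z := b.2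

/-- The centre of the disc. -/
def origin : ball (0 : ℂ) 1 := ⟨0, mem_ball_self one_pos⟩

/-- The coordinate function. -/
noncomputable def coord : discAlgebra :=
  (exists_of_bounded (M := 1) (h := fun z => z) differentiableOn_id
    fun z hz => by simpa using (mem_ball_zero_iff.1 hz).le).choose

theorem ev_coord (z : ball (0 : ℂ) 1) : ev z coord = z :=
  (exists_of_bounded (M := 1) (h := fun z => z) differentiableOn_id
    fun z hz => by simpa using (mem_ball_zero_iff.1 hz).le).choose_spec z

/-- Cancellation of `z` is clear off the origin and extends there by continuity. This uniqueness
makes the backward shift linear. -/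
theorem eq_of_coord_mul_eq {b c : discAlgebra} (h : ∀ z : ball (0 : ℂ) 1, z * ev z b = z * ev z c) :
    b = c := by
  obtain ⟨f, hf, hbf⟩ := exists_extension b
  obtain ⟨g, hg, hcg⟩ := exists_extension c
  have h0 : (0 : ℂ) ∈ ball (0 : ℂ) 1 := mem_ball_self one_pos
  have hne : ∀ z : ball (0 : ℂ) 1, (z : ℂ) ≠ 0 → f z = g z := fun z hz => by
    rw [← hbf, ← hcg]; exact mul_left_cancel₀ hz (h z)
  refine ext_ev fun z => ?_
  rw [hbf, hcg]
  by_cases hz : (z : ℂ) = 0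
  · rw [hz]
    have hfc := (hf.differentiableAt (ball_mem_nhds _ one_pos)).continuousAt
    have hgc := (hg.differentiableAt (ball_mem_nhds _ one_pos)).continuousAt
    have e : f =ᶠ[𝓝[≠] 0] g := by
      filter_upwards [self_mem_nhdsWithin, nhdsWithin_le_nhds (ball_mem_nhds (0 : ℂ) one_pos)]
        with w hw hw'
      exact hne ⟨w, hw'⟩ hw
    exact tendsto_nhds_unique ((hfc.tendsto.mono_left nhdsWithin_le_nhds).congr' e)
      (hgc.tendsto.mono_left nhdsWithin_le_nhds)
  · exact hne z hz

/-- The witness is the difference quotient at 0; the Schwarz lemma supplies the bound, which makes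
the shift a continuous operator. -/
theorem exists_shift (b : discAlgebra) : ∃ c : discAlgebra, ‖c‖ ≤ 2 * ‖b‖ ∧
    ∀ z : ball (0 : ℂ) 1, ev z b = ev origin b + z * ev z c := by
  obtain ⟨h, hd, hh⟩ := exists_extension b
  have hmaps : Set.MapsTo h (ball 0 1) (closedBall (h 0) (2 * ‖b‖)) := by
    intro z hz
    rw [mem_closedBall, dist_eq_norm]
    have h1 := norm_ev_le ⟨z, hz⟩ b
    have h2 := norm_ev_le origin b
    rw [hh] at h1 h2
    change ‖h z‖ ≤ _ at h1
    change ‖h 0‖ ≤ _ at h2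
    exact (norm_sub_le _ _).trans ((add_le_add h1 h2).trans_eq (two_mul _).symm)
  have hb : ∀ z ∈ ball (0 : ℂ) 1, ‖dslope h 0 z‖ ≤ 2 * ‖b‖ := fun z hz =>
    (Complex.norm_dslope_le_div_of_mapsTo_ball hd hmaps hz).trans_eq (div_one _)
  obtain ⟨c, hc⟩ := exists_of_bounded
    ((Complex.differentiableOn_dslope (ball_mem_nhds _ one_pos)).2 hd) hb
  refine ⟨c, norm_le_of_ev _ _ (by positivity) fun z => by rw [hc]; exact hb z z.2, fun z => ?_⟩
  have := sub_smul_dslope h 0 (z : ℂ)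
  rw [sub_zero, smul_eq_mul] at this
  rw [hc, this, hh, hh]
  change _ = h 0 + _
  ring

theorem exists_shiftCLM : ∃ S : discAlgebra →L[ℂ] discAlgebra,
    ∀ b z, ev z b = ev origin b + z * ev z (S b) := by
  choose S hS hS' using exists_shift
  refine ⟨LinearMap.mkContinuous
    { toFun := S
      map_add' := fun a b => eq_of_coord_mul_eq fun z => ?_
      map_smul' := fun r a => eq_of_coord_mul_eq fun z => ?_ } 2 hS, hS'⟩
  · have hab := hS' (a + b) z
    simp only [map_add] at hab ⊢
    linear_combination -hab + hS' a z + hS' b z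
  · have hra := hS' (r • a) z
    simp only [map_smul, smul_eq_mul, RingHom.id_apply] at hra ⊢
    linear_combination -hra + r * hS' a z

/-- The backward shift `b ↦ (b - b 0) / z`. -/
noncomputable def shift : discAlgebra →L[ℂ] discAlgebra := exists_shiftCLM.choose

theorem ev_eq_add_shift (b : discAlgebra) (z : ball (0 : ℂ) 1) :
    ev z b = ev origin b + z * ev z (shift b) :=
  exists_shiftCLM.choose_spec b z

theorem eq_add_shift (b : discAlgebra) : b = ev origin b • 1 + coord * shift b :=
  ext_ev fun z => by
    rw [map_add, map_smul, ev_mul, ev_coord, ev_one, smul_eq_mul, mul_one, ← ev_eq_add_shift]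

/-- Taylor's formula with remainder, which is division by `z ^ d` in the algebra. Weierstrass
division is a perturbation of this identity. -/
theorem eq_sum_add_shift (d : ℕ) (b : discAlgebra) :
    b = ∑ k ∈ Finset.range d, ev origin ((shift ^ k) b) • coord ^ k + coord ^ d * (shift ^ d) b := by
  induction d with
  | zero => simp
  | succ d ih =>
    rw [Finset.sum_range_succ, add_assoc]
    refine ih.trans ?_
    congr 1
    have := eq_add_shift ((shift ^ d) b)
    nth_rewrite 1 [this]
    rw [pow_succ' shift, mul_apply_eq_comp, mul_add, pow_succ coord, mul_assoc]
    simp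

/-- Evaluation is holomorphic in the point, as a map into the dual space. -/
theorem differentiableAt_of_ev {F : ℂ → discAlgebra →L[ℂ] ℂ}
    (hF : ∀ z : ball (0 : ℂ) 1, F z = ev z) {z : ℂ} (hz : z ∈ ball (0 : ℂ) 1) :
    DifferentiableAt ℂ F z := by
  obtain ⟨r, hr, hrz⟩ := Metric.isOpen_iff.1 isOpen_ball z hz
  refine differentiableAt_of_norming (B := discAlgebra →L[ℂ] ℂ) (ι := {b : discAlgebra // ‖b‖ ≤ 1})
    (fun b => ContinuousLinearMap.apply ℂ ℂ b.1) ?_ hr (M := 1) ?_ ?_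
  · intro l C hC h
    refine l.opNorm_le_of_unit_norm (𝕜 := ℂ) hC ?_
    intro b hb
    exact h ⟨b, hb.le⟩
  · rintro ⟨b, hb⟩ x hx
    change ‖F x b‖ ≤ 1
    rw [hF ⟨x, hrz hx⟩]
    exact (norm_ev_le _ _).trans hb
  · rintro ⟨b, hb⟩
    obtain ⟨h, hd, hh⟩ := exists_extension b
    refine (hd.mono hrz).congr fun x hx => ?_
    change F x b = h x
    rw [hF ⟨x, hrz hx⟩, hh]

/-- Evaluation at a complex number, extended by zero outside the unit disc. -/
noncomputable def eval (z : ℂ) : discAlgebra →L[ℂ] ℂ :=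
  open Classical in if hz : z ∈ ball (0 : ℂ) 1 then ev ⟨z, hz⟩ else 0

theorem eval_coe (z : ball (0 : ℂ) 1) : eval z = ev z := by simp [eval, z.2]

theorem differentiableAt_eval {z : ℂ} (hz : z ∈ ball (0 : ℂ) 1) : DifferentiableAt ℂ eval z :=
  differentiableAt_of_ev eval_coe hz

end discAlgebra

end DiscAlgebra

/-! ### Holomorphic families and Weierstrass division. -/

section HolomorphicNear

open Metric Filter Topology

variable {E F : Type*} [NormedAddCommGroup E] [NormedSpace ℂ E]
  [NormedAddCommGroup F] [NormedSpace ℂ F]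

namespace discAlgebra

/-- A bounded function on `ball x₀ r × disc`, holomorphic in each variable separately, is a
holomorphic family of elements of the disc algebra. -/
theorem exists_family {φ : E → ℂ → ℂ} {x₀ : E} {r M : ℝ}
    (hM : ∀ x ∈ ball x₀ r, ∀ z ∈ ball (0 : ℂ) 1, ‖φ x z‖ ≤ M)
    (hz : ∀ x ∈ ball x₀ r, DifferentiableOn ℂ (φ x) (ball 0 1))
    (hx : ∀ z ∈ ball (0 : ℂ) 1, DifferentiableOn ℂ (fun x => φ x z) (ball x₀ r)) :
    ∃ Φ : E → discAlgebra, DifferentiableOn ℂ Φ (ball x₀ r) ∧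
      ∀ x ∈ ball x₀ r, ∀ z, ev z (Φ x) = φ x z := by
  have : ∀ x : E, ∃ b : discAlgebra, x ∈ ball x₀ r → ∀ z, ev z b = φ x z := by
    intro x
    by_cases h : x ∈ ball x₀ r
    · obtain ⟨b, hb⟩ := exists_of_bounded (hz x h) (hM x h)
      exact ⟨b, fun _ => hb⟩
    · exact ⟨0, fun h' => (h h').elim⟩
  choose Φ hΦ using this
  refine ⟨Φ, fun x hxm => ?_, hΦ⟩
  obtain ⟨s, hs, hsub⟩ := Metric.isOpen_iff.1 isOpen_ball x hxm
  refine (differentiableAt_of_norming ev norm_le_of_ev hs (M := M) ?_ ?_).differentiableWithinAt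
  · intro z y hy
    rw [hΦ y (hsub hy)]; exact hM y (hsub hy) z z.2
  · intro z
    exact ((hx z z.2).mono hsub).congr fun y hy => hΦ y (hsub hy) z

theorem hasDerivAt_of_ev {b : discAlgebra} {h : ℂ → ℂ}
    (hb : ∀ z : ball (0 : ℂ) 1, ev z b = h z) : HasDerivAt h (ev origin (shift b)) 0 := by
  obtain ⟨k, hk, hbk⟩ := exists_extension (shift b)
  have e : h =ᶠ[𝓝 0] fun z => ev origin b + z * k z := by
    filter_upwards [ball_mem_nhds (0 : ℂ) one_pos] with z hz
    rw [← hb ⟨z, hz⟩, ev_eq_add_shift, hbk]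
  have hd := (hk.differentiableAt (ball_mem_nhds _ one_pos)).hasDerivAt
  refine HasDerivAt.congr_of_eventuallyEq ?_ e
  have := ((hasDerivAt_id (0 : ℂ)).mul hd).const_add (ev origin b)
  rw [hbk]
  simpa [origin] using this

end discAlgebra

/-- Directional derivatives of holomorphic functions are holomorphic. -/
theorem DifferentiableOn.fderiv_apply_complex {f : E → ℂ} {s : Set E} (hs : IsOpen s)
    (hf : DifferentiableOn ℂ f s) (v : E) :
    DifferentiableOn ℂ (fun x => fderiv ℂ f x v) s := by
  intro x₀ hx₀
  have hfx := hf.differentiableAt (hs.mem_nhds hx₀)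
  have hbd : ∀ᶠ x in 𝓝 x₀, ‖f x‖ < ‖f x₀‖ + 1 :=
    hfx.continuousAt.norm.eventually_lt continuousAt_const (by simp)
  obtain ⟨R, hR, hRs⟩ := Metric.mem_nhds_iff.1 (hbd.and (hs.mem_nhds hx₀))
  obtain ⟨c, hc, hcR⟩ : ∃ c : ℝ, 0 < c ∧ c * ‖v‖ < R / 2 := by
    refine ⟨R / 2 / (‖v‖ + 1), by positivity, ?_⟩
    rw [div_mul_eq_mul_div, div_lt_iff₀ (by positivity)]
    nlinarith [norm_nonneg v]
  have hcn : ‖(c : ℂ)‖ = c := by rw [Complex.norm_real, Real.norm_of_nonneg hc.le]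
  have hmem : ∀ x ∈ ball x₀ (R / 2), ∀ z ∈ ball (0 : ℂ) 1, x + z • (c : ℂ) • v ∈ ball x₀ R := by
    intro x hx z hz
    rw [mem_ball_iff_norm] at hx ⊢
    rw [mem_ball_zero_iff] at hz
    have h1 : ‖z • (c : ℂ) • v‖ ≤ c * ‖v‖ := by
      rw [norm_smul, norm_smul, hcn]
      exact mul_le_of_le_one_left (by positivity) hz.le
    calc ‖x + z • (c : ℂ) • v - x₀‖ = ‖(x - x₀) + z • (c : ℂ) • v‖ := by congr 1; abel
      _ ≤ ‖x - x₀‖ + ‖z • (c : ℂ) • v‖ := norm_add_le _ _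
      _ < R := by linarith
  have hdiff : ∀ y ∈ ball x₀ R, DifferentiableAt ℂ f y := fun y hy =>
    hf.differentiableAt (hs.mem_nhds (hRs hy).2)
  -- The slices `z ↦ f (x + z c v)` form a holomorphic family, and the derivative at `z = 0` is a
  -- continuous linear functional of the slice. The scale `c` keeps the slices within the ball where
  -- `f` is bounded.
  obtain ⟨Φ, hΦ, hev⟩ := discAlgebra.exists_family
    (φ := fun x z => f (x + z • (c : ℂ) • v)) (x₀ := x₀) (r := R / 2) (M := ‖f x₀‖ + 1)
    (fun x hx z hz => (hRs (hmem x hx z hz)).1.le)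
    (fun x hx z hz => DifferentiableAt.differentiableWithinAt <|
      (hdiff _ (hmem x hx z hz)).comp z (f := fun z : ℂ => x + z • (c : ℂ) • v) (by fun_prop))
    (fun z hz x hx => DifferentiableAt.differentiableWithinAt <|
      (hdiff _ (hmem x hx z hz)).comp x (f := fun x => x + z • (c : ℂ) • v) (by fun_prop))
  have hder : ∀ x ∈ ball x₀ (R / 2), fderiv ℂ f x v =
      (c : ℂ)⁻¹ * discAlgebra.ev discAlgebra.origin (discAlgebra.shift (Φ x)) := by
    intro x hx
    have h1 := discAlgebra.hasDerivAt_of_ev (h := fun z => f (x + z • (c : ℂ) • v)) (hev x hx)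
    have hxd : HasFDerivAt f (fderiv ℂ f x) (x + (0 : ℂ) • (c : ℂ) • v) := by
      simpa using (hdiff x (by simpa using hmem x hx 0 (mem_ball_self one_pos))).hasFDerivAt
    have h2 : HasDerivAt (fun z : ℂ => x + z • (c : ℂ) • v) ((c : ℂ) • v) 0 := by
      simpa using ((hasDerivAt_id (0 : ℂ)).smul_const ((c : ℂ) • v)).const_add x
    have h3 := (hxd.comp_hasDerivAt (0 : ℂ) h2).unique h1
    rw [← h3, map_smul, smul_eq_mul, inv_mul_cancel_left₀]
    exact_mod_cast hc.ne'
  have hloc : DifferentiableAt ℂ (fun x => (c : ℂ)⁻¹ *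
      discAlgebra.ev discAlgebra.origin (discAlgebra.shift (Φ x))) x₀ := by
    have := hΦ.differentiableAt (ball_mem_nhds x₀ (half_pos hR))
    fun_prop
  refine (hloc.congr_of_eventuallyEq ?_).differentiableWithinAt
  filter_upwards [ball_mem_nhds x₀ (half_pos hR)] with x hx using hder x hx

/-- Directional derivatives are again scalar holomorphic functions, and in finite dimension they
control the full derivative, so induction on the order applies. -/
theorem DifferentiableOn.contDiffOn_complex_of_finiteDimensional [FiniteDimensional ℂ E] {f : E → ℂ}
    {s : Set E} (hs : IsOpen s) (hf : DifferentiableOn ℂ f s) : ContDiffOn ℂ ∞ f s := by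
  rw [contDiffOn_infty]
  intro n
  induction n generalizing f with
  | zero => exact contDiffOn_zero.2 hf.continuousOn
  | succ n ih =>
    have : ((n + 1 : ℕ) : WithTop ℕ∞) = (n : WithTop ℕ∞) + 1 := by norm_cast
    rw [this, contDiffOn_succ_iff_fderiv_apply hs.uniqueDiffOn]
    refine ⟨hf, fun h => by simp at h, fun v => ?_⟩
    refine (ih (hf.fderiv_apply_complex hs v)).congr fun x hx => ?_
    rw [fderivWithin_of_isOpen hs hx]

/-- A map which is holomorphic in a neighbourhood of the origin. -/
def HolomorphicNearZero (φ : E → F) : Prop := ∀ᶠ x in 𝓝 0, DifferentiableAt ℂ φ x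

namespace HolomorphicNearZero

theorem fderiv_apply_const {φ : E → ℂ} (h : HolomorphicNearZero φ) (v : E) :
    HolomorphicNearZero fun x => fderiv ℂ φ x v := by
  obtain ⟨s, hs, hso, h0⟩ := _root_.eventually_nhds_iff.1 h
  filter_upwards [hso.mem_nhds h0] with x hx
  exact (DifferentiableOn.fderiv_apply_complex hso
    (fun y hy => (hs y hy).differentiableWithinAt) v).differentiableAt (hso.mem_nhds hx)

theorem fderiv_apply [FiniteDimensional ℂ E] {φ : E → ℂ} {c : E → E} (h : HolomorphicNearZero φ)
    (hc : HolomorphicNearZero c) : HolomorphicNearZero fun x => fderiv ℂ φ x (c x) := by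
  let b := Module.finBasis ℂ E
  have hb : ∀ x, fderiv ℂ φ x (c x) =
      ∑ i, (b.coord i).toContinuousLinearMap (c x) * fderiv ℂ φ x (b i) := by
    intro x
    have := congrArg (fderiv ℂ φ x) (b.sum_repr (c x))
    rw [map_sum] at this
    rw [← this]
    simp
  simp_rw [hb]
  have := (eventually_all (ι := Fin (Module.finrank ℂ E))).2 fun i => h.fderiv_apply_const (b i)
  filter_upwards [hc, this] with x h1 h2
  refine DifferentiableAt.fun_sum fun i _ => ?_
  exact ((ContinuousLinearMap.differentiableAt _).comp x h1).mul (h2 i)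

theorem comp_differentiable {G : Type*} [NormedAddCommGroup G] [NormedSpace ℂ G]
    {φ : F → G} {c : E → F} (h : HolomorphicNearZero φ) (hc : Differentiable ℂ c) (h0 : c 0 = 0) :
    HolomorphicNearZero fun x => φ (c x) := by
  have : Tendsto c (𝓝 0) (𝓝 0) := by simpa [h0] using hc.continuous.tendsto 0
  filter_upwards [this.eventually h] with x hx using hx.comp x (hc x)

end HolomorphicNearZero

/-- A holomorphic family of linear equations which is trivial at the origin has a holomorphic
solution. -/
theorem exists_holomorphic_solution {B : Type*} [NormedCommRing B] [NormedAlgebra ℂ B]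
    [CompleteSpace B] (T₀ S : B →L[ℂ] B) (c : ℂ) {G Φ : E → B} {r : ℝ} (hr : 0 < r)
    (hG : DifferentiableOn ℂ G (ball 0 r)) (hΦ : DifferentiableOn ℂ Φ (ball 0 r))
    (h0 : ∀ b, T₀ b + c • (G 0 * S b) = b) :
    ∃ ψ : E → B, ∀ᶠ x in 𝓝 (0 : E),
      DifferentiableAt ℂ ψ x ∧ T₀ (ψ x) + c • (G x * S (ψ x)) = Φ x := by
  let m : B →L[ℂ] B →L[ℂ] B := ContinuousLinearMap.mul ℂ B
  let T : E → B →L[ℂ] B := fun x => T₀ + c • (m (G x)).comp S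
  have hTd : ∀ x ∈ ball (0 : E) r, DifferentiableAt ℂ T x := by
    intro x hx
    have h1 := hG.differentiableAt (isOpen_ball.mem_nhds hx)
    have h2 : DifferentiableAt ℂ (fun x => m (G x)) x := m.differentiableAt.comp x h1
    exact (((h2.clm_comp (differentiableAt_const S)).const_smul c).const_add T₀)
  have hT0 : T 0 = 1 := ContinuousLinearMap.ext h0
  -- Units of the operator algebra are open and inversion is holomorphic there, so the solution is
  -- the inverse operator applied to the right-hand side.
  have hunit : ∀ᶠ x in 𝓝 (0 : E), IsUnit (T x) := by
    have h := (hTd 0 (mem_ball_self hr)).continuousAt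
    have : {u : B →L[ℂ] B | IsUnit u} ∈ 𝓝 (T 0) :=
      Units.isOpen.mem_nhds (by rw [hT0]; exact isUnit_one)
    exact h this
  refine ⟨fun x => Ring.inverse (T x) (Φ x), ?_⟩
  filter_upwards [hunit, ball_mem_nhds (0 : E) hr] with x hu hx
  refine ⟨?_, ?_⟩
  · have h1 : DifferentiableAt ℂ (fun x => Ring.inverse (T x)) x :=
      (differentiableAt_inverse (𝕜 := ℂ) hu).comp x (hTd x hx)
    exact h1.clm_apply (hΦ.differentiableAt (isOpen_ball.mem_nhds hx))
  · change (T x * Ring.inverse (T x)) (Φ x) = Φ x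
    rw [Ring.mul_inverse_cancel _ hu]; rfl

open discAlgebra in
/-- Weierstrass division by a function which is `t ^ d` along the last coordinate axis. -/
theorem weierstrass_division_of_eq_pow {g φ : E × ℂ → ℂ} (hg : HolomorphicNearZero g)
    (hφ : HolomorphicNearZero φ) {d : ℕ} (h0 : ∀ᶠ t in 𝓝 (0 : ℂ), g (0, t) = t ^ d) :
    ∃ (q : E × ℂ → ℂ) (a : ℕ → E → ℂ), HolomorphicNearZero q ∧
      (∀ k, HolomorphicNearZero (a k)) ∧
      ∀ᶠ p in 𝓝 (0 : E × ℂ), φ p = q p * g p + ∑ k ∈ Finset.range d, a k p.1 * p.2 ^ k := by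
  have bdd : ∀ ψ : E × ℂ → ℂ, HolomorphicNearZero ψ →
      ∀ᶠ p in 𝓝 (0 : E × ℂ), ‖ψ p‖ < ‖ψ 0‖ + 1 := fun ψ hψ =>
    hψ.self_of_nhds.continuousAt.norm.eventually_lt continuousAt_const (by simp)
  obtain ⟨ρ₁, hρ₁, h₁⟩ := Metric.mem_nhds_iff.1
    ((hg.and hφ).and ((bdd g hg).and (bdd φ hφ)))
  obtain ⟨ρ₂, hρ₂, h₂⟩ := Metric.mem_nhds_iff.1 h0
  set ρ := min ρ₁ ρ₂ with hρdef
  have hρ : 0 < ρ := lt_min hρ₁ hρ₂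
  have hρn : ‖(ρ : ℂ)‖ = ρ := by rw [Complex.norm_real, Real.norm_of_nonneg hρ.le]
  have hρ0 : (ρ : ℂ) ≠ 0 := by exact_mod_cast hρ.ne'
  have hscale : ∀ z ∈ ball (0 : ℂ) 1, ‖(ρ : ℂ) * z‖ < ρ := by
    intro z hz
    rw [norm_mul, hρn]
    exact mul_lt_of_lt_one_right hρ (mem_ball_zero_iff.1 hz)
  have hmem : ∀ x ∈ ball (0 : E) ρ, ∀ z ∈ ball (0 : ℂ) 1, (x, (ρ : ℂ) * z) ∈ ball (0 : E × ℂ) ρ₁ := by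
    intro x hx z hz
    rw [mem_ball_zero_iff, Prod.norm_mk]
    exact (max_lt (mem_ball_zero_iff.1 hx) (hscale z hz)).trans_le (min_le_left _ _)
  have fam : ∀ ψ : E × ℂ → ℂ, (∀ p ∈ ball (0 : E × ℂ) ρ₁, DifferentiableAt ℂ ψ p) →
      (∀ p ∈ ball (0 : E × ℂ) ρ₁, ‖ψ p‖ < ‖ψ 0‖ + 1) →
      ∃ Ψ : E → discAlgebra, DifferentiableOn ℂ Ψ (ball 0 ρ) ∧
        ∀ x ∈ ball (0 : E) ρ, ∀ z, ev z (Ψ x) = ψ (x, (ρ : ℂ) * z) := by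
    intro ψ hd hb
    refine exists_family (φ := fun x z => ψ (x, (ρ : ℂ) * z)) (M := ‖ψ 0‖ + 1)
      (fun x hx z hz => (hb _ (hmem x hx z hz)).le) (fun x hx z hz => ?_) (fun z hz x hx => ?_)
    · exact ((hd _ (hmem x hx z hz)).comp z (f := fun z : ℂ => (x, (ρ : ℂ) * z))
        (by fun_prop)).differentiableWithinAt
    · exact ((hd _ (hmem x hx z hz)).comp x (f := fun x : E => (x, (ρ : ℂ) * z))
        (by fun_prop)).differentiableWithinAt
  obtain ⟨G, hGd, hG⟩ := fam g (fun p hp => (h₁ hp).1.1) (fun p hp => (h₁ hp).2.1)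
  obtain ⟨Φ, hΦd, hΦ⟩ := fam φ (fun p hp => (h₁ hp).1.2) (fun p hp => (h₁ hp).2.2)
  -- Taylor truncation below degree `d`. The equation for `ψ` uses the Taylor coefficients of `ψ` as
  -- remainder coefficients and its `d`-th shift as quotient, up to powers of the scale `ρ`.
  let T₀ : discAlgebra →L[ℂ] discAlgebra :=
    ∑ k ∈ Finset.range d, ((ev origin).comp (shift ^ k)).smulRight (coord ^ k)
  have hT₀ : ∀ b, T₀ b = ∑ k ∈ Finset.range d, ev origin ((shift ^ k) b) • coord ^ k := by
    intro b
    simp only [T₀, sum_apply, ContinuousLinearMap.smulRight_apply,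
      ContinuousLinearMap.comp_apply]
  have hG0 : G 0 = (ρ : ℂ) ^ d • coord ^ d := by
    refine ext_ev fun z => ?_
    rw [hG 0 (mem_ball_self hρ), map_smul, ev_pow, ev_coord, smul_eq_mul, ← mul_pow]
    exact h₂ (mem_ball_zero_iff.2 ((hscale z z.2).trans_le (min_le_right _ _)))
  obtain ⟨ψ, hψ⟩ := exists_holomorphic_solution T₀ (shift ^ d) ((ρ : ℂ) ^ d)⁻¹ hρ hGd hΦd <| by
    intro b
    rw [hT₀, hG0, smul_mul_assoc, smul_smul, inv_mul_cancel₀ (pow_ne_zero _ hρ0), one_smul]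
    exact (eq_sum_add_shift d b).symm
  have hfst : Tendsto (Prod.fst : E × ℂ → E) (𝓝 0) (𝓝 0) := continuous_fst.tendsto (0 : E × ℂ)
  have hsnd : ∀ᶠ p in 𝓝 (0 : E × ℂ), (ρ : ℂ)⁻¹ * p.2 ∈ ball (0 : ℂ) 1 := by
    have : Tendsto (fun p : E × ℂ => (ρ : ℂ)⁻¹ * p.2) (𝓝 0) (𝓝 0) := by
      have h : Continuous fun p : E × ℂ => (ρ : ℂ)⁻¹ * p.2 := by fun_prop
      simpa using h.tendsto 0
    exact this (ball_mem_nhds _ one_pos)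
  refine ⟨fun p => ((ρ : ℂ) ^ d)⁻¹ * eval ((ρ : ℂ)⁻¹ * p.2) ((shift ^ d) (ψ p.1)),
    fun k x => ((ρ : ℂ) ^ k)⁻¹ * ev origin ((shift ^ k) (ψ x)), ?_, ?_, ?_⟩
  · filter_upwards [hfst.eventually hψ, hsnd] with p hp hp2
    have hlin : DifferentiableAt ℂ (fun p : E × ℂ => (ρ : ℂ)⁻¹ * p.2) p :=
      differentiableAt_snd.const_mul (ρ : ℂ)⁻¹
    have h1 : DifferentiableAt ℂ (fun p : E × ℂ => eval ((ρ : ℂ)⁻¹ * p.2)) p :=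
      DifferentiableAt.comp (g := eval) p (differentiableAt_eval hp2) hlin
    have h2 : DifferentiableAt ℂ (fun p : E × ℂ => (shift ^ d) (ψ p.1)) p :=
      (ContinuousLinearMap.differentiableAt _).comp p (hp.1.comp p differentiableAt_fst)
    exact (h1.clm_apply h2).const_mul _
  · intro k
    filter_upwards [hψ] with x hx
    have := hx.1
    fun_prop
  · filter_upwards [hfst.eventually hψ, hfst.eventually (ball_mem_nhds (0 : E) hρ), hsnd]
      with p hp hpx hp2
    have key := congrArg (ev ⟨_, hp2⟩) hp.2
    have hcancel : (ρ : ℂ) * ((ρ : ℂ)⁻¹ * p.2) = p.2 := mul_inv_cancel_left₀ hρ0 _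
    rw [hΦ p.1 hpx, hT₀, map_add, map_sum, map_smul, ev_mul, hG p.1 hpx] at key
    simp only [map_smul, ev_pow, ev_coord, smul_eq_mul, hcancel] at key
    have heval : eval ((ρ : ℂ)⁻¹ * p.2) = ev ⟨_, hp2⟩ := eval_coe ⟨_, hp2⟩
    rw [heval, ← key, add_comm]
    congr 1
    · ring
    · refine Finset.sum_congr rfl fun k _ => ?_
      rw [mul_pow, inv_pow]; ring

/-- Weierstrass division. -/
theorem weierstrass_division {g : E × ℂ → ℂ} (hg : HolomorphicNearZero g)
    (h0 : ¬ ∀ᶠ t in 𝓝 (0 : ℂ), g (0, t) = 0) :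
    ∃ d : ℕ, ∀ φ : E × ℂ → ℂ, HolomorphicNearZero φ →
    ∃ (q : E × ℂ → ℂ) (a : ℕ → E → ℂ), HolomorphicNearZero q ∧
      (∀ k, HolomorphicNearZero (a k)) ∧
      ∀ᶠ p in 𝓝 (0 : E × ℂ), φ p = q p * g p + ∑ k ∈ Finset.range d, a k p.1 * p.2 ^ k := by
  have hax : HolomorphicNearZero fun t : ℂ => g ((0 : E), t) :=
    hg.comp_differentiable (c := fun t : ℂ => ((0 : E), t)) (by fun_prop) rfl
  -- On the axis `g` is `t ^ d` times a unit `e t`; dividing `g` by `e` reduces to the previous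
  -- case.
  obtain ⟨d, e, he, he0, hge⟩ :=
    (Complex.analyticAt_iff_eventually_differentiableAt.2
      hax).exists_eventuallyEq_pow_smul_nonzero_iff.2 h0
  have hev : ∀ᶠ t in 𝓝 (0 : ℂ), e t ≠ 0 ∧ DifferentiableAt ℂ e t :=
    (he.continuousAt.eventually_ne he0).and (Complex.analyticAt_iff_eventually_differentiableAt.1 he)
  have hsnd : Tendsto (Prod.snd : E × ℂ → ℂ) (𝓝 0) (𝓝 0) := continuous_snd.tendsto (0 : E × ℂ)
  have hinv : ∀ {ψ : E × ℂ → ℂ}, HolomorphicNearZero ψ →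
      HolomorphicNearZero fun p => ψ p * (e p.2)⁻¹ := by
    intro ψ hψ
    filter_upwards [hψ, hsnd.eventually hev] with p h1 h2
    exact h1.mul ((h2.2.comp p differentiableAt_snd).inv h2.1)
  refine ⟨d, fun φ hφ => ?_⟩
  obtain ⟨q, a, hq, ha, h⟩ := weierstrass_division_of_eq_pow (hinv hg) hφ (d := d) <| by
    filter_upwards [hev, hge] with t h1 h2
    rw [h2, sub_zero, smul_eq_mul, mul_assoc, mul_inv_cancel₀ h1.1, mul_one]
  refine ⟨fun p => q p * (e p.2)⁻¹, a, hinv hq, ha, ?_⟩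
  filter_upwards [h] with p hp
  rw [hp]; ring

end HolomorphicNear

/-! ### Constants of derivations in algebraic extensions. -/

section ConstantFields

open Polynomial

variable {A A' L : Type*} [CommRing A] [CommRing A'] [Field L]

/-- `κ ∘ D` is a derivation from `A` to `L`, where `L` is an `A`-module through `κ`. -/
structure IsDerivationAlong (κ : A →+* L) (D : A → A) : Prop where
  map_add : ∀ x y, κ (D (x + y)) = κ (D x) + κ (D y)
  leibniz : ∀ x y, κ (D (x * y)) = κ x * κ (D y) + κ y * κ (D x)

namespace IsDerivationAlong

variable {κ : A →+* L} {D : A → A}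

theorem map_zero (h : IsDerivationAlong κ D) : κ (D 0) = 0 := by
  simpa using h.map_add 0 0

theorem map_one (h : IsDerivationAlong κ D) : κ (D 1) = 0 := by
  simpa using h.leibniz 1 1

theorem map_sum {ι : Type*} (h : IsDerivationAlong κ D) (s : Finset ι) (f : ι → A) :
    κ (D (∑ i ∈ s, f i)) = ∑ i ∈ s, κ (D (f i)) := by
  classical
  induction s using Finset.induction_on with
  | empty => simpa using h.map_zero
  | insert i s hi ih => rw [Finset.sum_insert hi, Finset.sum_insert hi, h.map_add, ih]

theorem map_pow (h : IsDerivationAlong κ D) (x : A) (n : ℕ) :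
    κ (D (x ^ n)) = n * κ x ^ (n - 1) * κ (D x) := by
  induction n with
  | zero => simpa using h.map_one
  | succ n ih =>
    rw [pow_succ, h.leibniz, ih]
    rcases n with _ | n
    · simp
    · simp only [Nat.add_sub_cancel, _root_.map_pow]
      push_cast
      ring

/-- Elements with a common logarithmic derivative `l` have monomials whose logarithmic derivative
depends only on the total degree. Homogeneous relations between `u` and `v` can thus be
differentiated without forming `u / v`. -/
theorem map_pow_mul_pow (h : IsDerivationAlong κ D) {u v : A} {l : L}
    (hu : κ (D u) = l * κ u) (hv : κ (D v) = l * κ v) (i j : ℕ) :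
    κ (D (u ^ i * v ^ j)) = (i + j : ℕ) * l * (κ u ^ i * κ v ^ j) := by
  have key : ∀ (x : A) (n : ℕ), κ (D x) = l * κ x → κ (D (x ^ n)) = n * l * κ x ^ n := by
    intro x n hx
    rw [h.map_pow, hx]
    rcases n with _ | n
    · simp
    · simp only [Nat.add_sub_cancel]; ring
  rw [h.leibniz, key u i hu, key v j hv, _root_.map_pow, _root_.map_pow]
  push_cast
  ring

/-- The chain rule for a polynomial expression in `t` with coefficients in `A'`. -/
theorem map_eval₂ (h : IsDerivationAlong κ D) {ι : A' →+* A} {t : A} {D' : A' → A'} {a b : L}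
    (hι : ∀ x, κ (D (ι x)) = a * κ (ι (D' x))) (ht : κ (D t) = b) (Q : A'[X]) :
    κ (D (Q.eval₂ ι t)) =
      a * ∑ i ∈ Finset.range (Q.natDegree + 1), κ (ι (D' (Q.coeff i))) * κ t ^ i +
        b * (derivative Q).eval₂ (κ.comp ι) (κ t) := by
  rw [eval₂_eq_sum_range, h.map_sum, derivative_apply, Polynomial.sum_over_range _ (by simp),
    eval₂_finsetSum, Finset.mul_sum, Finset.mul_sum, ← Finset.sum_add_distrib]
  refine Finset.sum_congr rfl fun i _ => ?_
  rw [h.leibniz, hι, h.map_pow, ht, _root_.map_pow]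
  simp
  ring

end IsDerivationAlong

/-- A minimal polynomial of an element of `L` over the image of `σ`, with coefficients lifted
along `σ`. -/
theorem exists_minimal_eval₂_eq_zero {σ : A' →+* L} {θ : L} {Q : A'[X]} (hQ : Q.map σ ≠ 0)
    (h0 : Q.eval₂ σ θ = 0) :
    ∃ P : A'[X], P.eval₂ σ θ = 0 ∧ σ P.leadingCoeff ≠ 0 ∧ 0 < P.natDegree ∧
      ∀ R : A'[X], R.eval₂ σ θ = 0 → R.natDegree < P.natDegree → R.map σ = 0 := by
  classical
  have hex : ∃ n, ∃ Q : A'[X], Q.map σ ≠ 0 ∧ Q.eval₂ σ θ = 0 ∧ (Q.map σ).natDegree = n :=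
    ⟨_, Q, hQ, h0, rfl⟩
  obtain ⟨Q₁, hQ₁, hQ₁0, hdeg⟩ := Nat.find_spec hex
  -- The map `σ` need not be injective. A lift of the same degree ensures that the leading
  -- coefficient survives under `σ`.
  obtain ⟨P, hPQ, hPdeg⟩ :=
    exists_degree_eq_of_mem_lifts ((mem_lifts (f := σ) (Q₁.map σ)).2 ⟨Q₁, rfl⟩)
  have hnat : P.natDegree = (Q₁.map σ).natDegree := natDegree_eq_of_degree_eq hPdeg
  have hP0 : P.eval₂ σ θ = 0 := by
    rw [eval₂_eq_eval_map, hPQ, ← eval₂_eq_eval_map, hQ₁0]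
  have hlc : σ P.leadingCoeff ≠ 0 := by
    rw [leadingCoeff, ← coeff_map, hPQ, hnat]
    exact leadingCoeff_ne_zero.2 hQ₁
  refine ⟨P, hP0, hlc, Nat.pos_of_ne_zero fun hd => ?_, fun R hR hRP => ?_⟩
  · rw [eq_C_of_natDegree_eq_zero hd, eval₂_C] at hP0
    rw [leadingCoeff, hd] at hlc
    exact hlc hP0
  · by_contra hne
    exact Nat.find_min hex (m := (R.map σ).natDegree)
      (by rw [← hdeg, ← hnat]; exact natDegree_map_le.trans_lt hRP) ⟨R, hne, hR, rfl⟩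

/-- If `D'` lifts to a derivation which kills `P(t)` for a minimal polynomial `P` of `t`, then the
lift preserves all polynomial relations of `t`. -/
theorem IsDerivationAlong.map_eval₂_eq_zero {κ : A →+* L} {D : A → A} (h : IsDerivationAlong κ D)
    {ι : A' →+* A} {t : A} {D' : A' → A'} {a b : L}
    (hι : ∀ x, κ (D (ι x)) = a * κ (ι (D' x))) (ht : κ (D t) = b)
    (hD' : ∀ x, κ (ι x) = 0 → κ (ι (D' x)) = 0) {P : A'[X]}
    (hP0 : P.eval₂ (κ.comp ι) (κ t) = 0) (hlc : κ (ι P.leadingCoeff) ≠ 0) (hPd : 0 < P.natDegree)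
    (hmin : ∀ R : A'[X], R.eval₂ (κ.comp ι) (κ t) = 0 → R.natDegree < P.natDegree →
      R.map (κ.comp ι) = 0)
    (hDP : κ (D (P.eval₂ ι t)) = 0) (Q : A'[X]) (hQ : Q.eval₂ (κ.comp ι) (κ t) = 0) :
    κ (D (Q.eval₂ ι t)) = 0 := by
  induction hn : Q.natDegree using Nat.strong_induction_on generalizing Q with
  | _ n ih =>
  rcases lt_or_ge n P.natDegree with hlt | hge
  · have hmap := hmin Q hQ (hn ▸ hlt)
    have hder : (derivative Q).eval₂ (κ.comp ι) (κ t) = 0 := by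
      rw [eval₂_eq_eval_map, ← derivative_map, hmap]; simp
    rw [h.map_eval₂ hι ht, hder, mul_zero, add_zero, Finset.sum_eq_zero, mul_zero]
    intro i _
    have : κ (ι (Q.coeff i)) = 0 := by
      have := congrArg (fun p => coeff p i) hmap
      simpa using this
    rw [hD' _ this, zero_mul]
  -- Pseudo-division by `P`: its leading coefficient is nonzero in `L` but need not be invertible in
  -- `A'`, so `Q` is multiplied by it before the top terms are cancelled.
  · set Q₁ : A'[X] := C P.leadingCoeff * Q - C Q.leadingCoeff * X ^ (n - P.natDegree) * P with hQ₁
    have e₁ : (C P.leadingCoeff * Q).natDegree ≤ n := (natDegree_C_mul_le _ _).trans hn.le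
    have e₂ : (C Q.leadingCoeff * X ^ (n - P.natDegree) * P).natDegree ≤ n := by
      refine natDegree_mul_le.trans ?_
      have := natDegree_C_mul_X_pow_le Q.leadingCoeff (n - P.natDegree)
      omega
    have hdeg : Q₁.natDegree < n := by
      have : Q₁.natDegree ≤ n - 1 := by
        rw [natDegree_le_iff_coeff_eq_zero]
        intro N hN
        rw [hQ₁, coeff_sub]
        rcases eq_or_ne N n with rfl | hne
        · rw [coeff_C_mul, mul_assoc, coeff_C_mul, coeff_X_pow_mul', if_pos (by omega),
            Nat.sub_sub_self hge]
          simp only [leadingCoeff, hn]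
          ring
        · rw [coeff_eq_zero_of_natDegree_lt (by omega), coeff_eq_zero_of_natDegree_lt (by omega),
            sub_zero]
      omega
    have hev : ∀ R : A'[X], κ (R.eval₂ ι t) = R.eval₂ (κ.comp ι) (κ t) := fun R => hom_eval₂ R ι κ t
    have hQ₁0 : Q₁.eval₂ (κ.comp ι) (κ t) = 0 := by
      rw [hQ₁, eval₂_sub, eval₂_mul, eval₂_mul, hQ, hP0]; simp
    have key : ι P.leadingCoeff * Q.eval₂ ι t =
        Q₁.eval₂ ι t + (C Q.leadingCoeff * X ^ (n - P.natDegree)).eval₂ ι t * P.eval₂ ι t := by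
      rw [hQ₁, eval₂_sub, eval₂_mul, eval₂_C, eval₂_mul _ _ (q := P)]; ring
    have := congrArg (fun x => κ (D x)) key
    simp only [h.map_add, h.leibniz, hev, hQ, hP0, hDP, ih _ hdeg _ hQ₁0 rfl] at this
    simpa [hlc] using this

/-- The field generated by the image of `κ` has no constants, with respect to the derivations in
`𝒟` which preserve the kernel of `κ`, except the complex numbers. -/
def ConstantsTrivial [Algebra ℂ A] (κ : A →+* L) (𝒟 : Set (A → A)) : Prop :=
  ∀ u v : A, κ v ≠ 0 →
    (∀ D ∈ 𝒟, (∀ x, κ x = 0 → κ (D x) = 0) → κ v * κ (D u) = κ u * κ (D v)) →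
    ∃ c : ℂ, κ u = κ (algebraMap ℂ A c) * κ v

theorem exists_eq_of_eval₂_eq_zero (σ : ℂ →+* L) {ρ : L} {Q : ℂ[X]} (hQ : Q ≠ 0)
    (h : Q.eval₂ σ ρ = 0) : ∃ c, ρ = σ c := by
  let _ := σ.toAlgebra
  have hint : IsIntegral ℂ ρ := IsAlgebraic.isIntegral ⟨Q, hQ, h⟩
  have hdeg := IsAlgClosed.degree_eq_one_of_irreducible ℂ (minpoly.irreducible hint)
  obtain ⟨c, hc⟩ := minpoly.mem_range_of_degree_eq_one ℂ ρ hdeg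
  exact ⟨c, hc.symm⟩

/-- If `τ` is integral over the image of `σ`, then quotients of polynomials in `τ` are algebraic
over the image of `σ`. -/
theorem exists_eval₂_div_eq_zero (σ : A' →+* L) {τ : L} {w : A'[X]} (hw : w.Monic)
    (hw0 : w.eval₂ σ τ = 0) (Q₁ Q₂ : A'[X]) :
    ∃ B : A'[X], B.map σ ≠ 0 ∧ B.eval₂ σ (Q₁.eval₂ σ τ / Q₂.eval₂ σ τ) = 0 := by
  have hτ : IsIntegral σ.range τ := by
    refine ⟨w.map σ.rangeRestrict, hw.map _, ?_⟩
    rw [eval₂_map]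
    exact hw0
  have halg : ∀ Q : A'[X], IsAlgebraic σ.range (Q.eval₂ σ τ) := by
    intro Q
    refine IsIntegral.isAlgebraic ?_
    have hmem := aeval_mem_adjoin_singleton σ.range (p := Q.map σ.rangeRestrict) τ
    have heq : aeval τ (Q.map σ.rangeRestrict) = Q.eval₂ σ τ := by
      rw [aeval_def, eval₂_map]; rfl
    rw [heq] at hmem
    exact adjoin_le_integralClosure hτ hmem
  obtain ⟨p, hp, hp0⟩ := (halg Q₁).mul (halg Q₂).inv
  obtain ⟨B, hB⟩ := Polynomial.map_surjective _ σ.rangeRestrict_surjective p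
  have hσ : σ = (algebraMap σ.range L).comp σ.rangeRestrict := rfl
  refine ⟨B, ?_, ?_⟩
  · rw [hσ, ← Polynomial.map_map, hB]
    exact (Polynomial.map_ne_zero_iff (Subtype.val_injective)).2 hp
  · rw [div_eq_mul_inv, hσ, ← eval₂_map, hB]
    exact hp0

/-- The induction step: triviality of constants passes from `A'` to a finite extension `A` of a
quotient of `A'` which is generated by `t`. -/
theorem ConstantsTrivial.of_integral_generator [Algebra ℂ A] [Algebra ℂ A'] {κ : A →+* L}
    {ι : A' →+* A} {t : A} {𝒟 : Set (A → A)} {𝒟' : Set (A' → A')}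
    (hιc : ∀ c, ι (algebraMap ℂ A' c) = algebraMap ℂ A c)
    (h𝒟 : ∀ D ∈ 𝒟, IsDerivationAlong κ D)
    (hA' : ConstantsTrivial (κ.comp ι) 𝒟')
    (hlift : ∀ D' ∈ 𝒟', ∀ a b : A, ∃ D ∈ 𝒟, (∀ x, κ (D (ι x)) = κ a * κ (ι (D' x))) ∧
      κ (D t) = κ b)
    {w : A'[X]} (hw : w.Monic) (hw0 : κ (w.eval₂ ι t) = 0)
    (hdiv : ∀ φ : A, ∃ (q : A) (Q : A'[X]),
      κ φ = κ (q * w.eval₂ ι t + Q.eval₂ ι t) ∧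
      ∀ D ∈ 𝒟, κ (D φ) = κ (D (q * w.eval₂ ι t + Q.eval₂ ι t))) :
    ConstantsTrivial κ 𝒟 := by
  set σ : A' →+* L := κ.comp ι with hσ
  have hσa : ∀ x, σ x = κ (ι x) := fun x => rfl
  have : CharZero L := charZero_of_injective_ringHom (κ.comp (algebraMap ℂ A)).injective
  have hev : ∀ R : A'[X], κ (R.eval₂ ι t) = R.eval₂ σ (κ t) :=
    fun R => hom_eval₂ R _ κ t
  rw [hev] at hw0
  obtain ⟨P, hP0, hlc, hPd, hmin⟩ := exists_minimal_eval₂_eq_zero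
    (by rw [Ne, ← leadingCoeff_eq_zero, (hw.map σ).leadingCoeff]; exact one_ne_zero) hw0
  -- the derivative of the minimal polynomial does not vanish
  have hP' : (derivative P).eval₂ σ (κ t) ≠ 0 := by
    intro h
    have h1 := hmin _ h (natDegree_derivative_lt hPd.ne')
    have h2 := congrArg (fun p => coeff p (P.natDegree - 1)) h1
    simp only [coeff_map, coeff_derivative, coeff_zero, Nat.sub_add_cancel hPd, _root_.map_mul,
      mul_eq_zero] at h2
    rcases h2 with h2 | h2
    · exact hlc h2
    · have : ((P.natDegree - 1 : ℕ) : L) + 1 = 0 := by simpa using h2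
      exact Nat.cast_add_one_ne_zero _ this
  -- derivations of `A'` lift
  have lift : ∀ D' ∈ 𝒟', (∀ x, σ x = 0 → σ (D' x) = 0) → ∃ D ∈ 𝒟, (∀ x, κ x = 0 → κ (D x) = 0) ∧
      ∃ a : L, a ≠ 0 ∧ ∀ x, κ (D (ι x)) = a * σ (D' x) := by
    intro D' hD' hpres
    -- The usual extension sends `t` to `-P^{D'}(t) / P'(t)`, where `P^{D'}` has `D'` applied to the
    -- coefficients. Scaling the whole derivation by `P'(t)` removes the denominator and makes it
    -- annihilate `P(t)`.
    obtain ⟨D, hD, hDι, hDt⟩ := hlift D' hD' ((derivative P).eval₂ ι t)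
      (-∑ i ∈ Finset.range (P.natDegree + 1), ι (D' (P.coeff i)) * t ^ i)
    have hder := h𝒟 D hD
    have hDP : κ (D (P.eval₂ ι t)) = 0 := by
      rw [hder.map_eval₂ hDι hDt, hev]
      simp only [map_neg, map_sum, map_mul, map_pow]
      ring
    have hrel := fun Q => hder.map_eval₂_eq_zero hDι hDt hpres hP0 hlc hPd hmin hDP Q
    refine ⟨D, hD, fun φ hφ => ?_, (derivative P).eval₂ σ (κ t), hP', fun x => ?_⟩
    · obtain ⟨q, Q, hq, hqD⟩ := hdiv φ
      rw [hφ, map_add, map_mul, hev, hev, hw0, mul_zero, zero_add] at hq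
      rw [hqD D hD, hder.map_add, hder.leibniz, hrel w hw0, hrel Q hq.symm, hev, hw0]
      ring
    · rw [hDι, hev]; rfl
  intro u v hv H
  set ρ : L := κ u / κ v with hρ
  have hu : κ u = ρ * κ v := (div_mul_cancel₀ _ hv).symm
  have hpoly : ∀ φ : A, ∃ Q : A'[X], κ φ = Q.eval₂ σ (κ t) := by
    intro φ
    obtain ⟨q, Q, hq, -⟩ := hdiv φ
    exact ⟨Q, by rw [hq, map_add, map_mul, hev, hev, hw0, mul_zero, zero_add]⟩
  obtain ⟨B₀, hB₀, hB₀0⟩ : ∃ B : A'[X], B.map σ ≠ 0 ∧ B.eval₂ σ ρ = 0 := by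
    obtain ⟨Q₁, h₁⟩ := hpoly u
    obtain ⟨Q₂, h₂⟩ := hpoly v
    rw [hρ, h₁, h₂]
    exact exists_eval₂_div_eq_zero σ hw hw0 Q₁ Q₂
  obtain ⟨B, hB0, hBlc, hBd, hBmin⟩ := exists_minimal_eval₂_eq_zero hB₀ hB₀0
  set m := B.natDegree with hm
  have hcoef : ∀ i, ∃ c : ℂ, σ (B.coeff i) = σ (algebraMap ℂ A' c) * σ B.leadingCoeff := by
    intro i
    -- Ratios of coefficients of the minimal polynomial of `ρ` are shown to be constants: a lifted
    -- derivation annihilates `ρ`, so differentiating `B(ρ) = 0` leaves a relation among the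
    -- differentiated coefficients.
    refine hA' _ _ hBlc fun D' hD' hpres => ?_
    obtain ⟨D, hD, hDpres, a, ha, hDι⟩ := lift D' hD' hpres
    have hder := h𝒟 D hD
    have hu' : κ (D u) = κ (D v) / κ v * κ u := by
      rw [div_mul_eq_mul_div, eq_div_iff hv, mul_comm, H D hD hDpres, mul_comm]
    have hv' : κ (D v) = κ (D v) / κ v * κ v := (div_mul_cancel₀ _ hv).symm
    have hpow : ∀ j ∈ Finset.range (m + 1), κ u ^ j * κ v ^ (m - j) = κ v ^ m * ρ ^ j := by
      intro j hj
      rw [hu, mul_pow, mul_assoc, ← pow_add, Nat.add_sub_cancel' (Nat.lt_succ_iff.1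
        (Finset.mem_range.1 hj)), mul_comm]
    have hBsum : ∑ j ∈ Finset.range (m + 1), σ (B.coeff j) * ρ ^ j = 0 := by
      rw [← hB0, eval₂_eq_sum_range]
    -- The homogenization of `B` at `(u, v)`; its image is `v ^ m B(ρ) = 0`. It lies in `A`, unlike
    -- `ρ`, so the kernel-preserving derivation can be applied to it.
    set Z : A := ∑ j ∈ Finset.range (m + 1), ι (B.coeff j) * (u ^ j * v ^ (m - j)) with hZ
    have hZ0 : κ Z = 0 := by
      rw [hZ, map_sum, ← mul_zero (κ v ^ m), ← hBsum, Finset.mul_sum]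
      refine Finset.sum_congr rfl fun j hj => ?_
      rw [map_mul, map_mul, map_pow, map_pow, hpow j hj, hσa]; ring
    have hDsum : ∑ j ∈ Finset.range (m + 1), σ (D' (B.coeff j)) * ρ ^ j = 0 := by
      have h1 := hDpres Z hZ0
      rw [hZ, hder.map_sum] at h1
      have h2 : ∀ j ∈ Finset.range (m + 1), κ (D (ι (B.coeff j) * (u ^ j * v ^ (m - j)))) =
          (m * (κ (D v) / κ v) * κ v ^ m) * (σ (B.coeff j) * ρ ^ j) +
            (κ v ^ m * a) * (σ (D' (B.coeff j)) * ρ ^ j) := by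
        intro j hj
        rw [hder.leibniz, hder.map_pow_mul_pow hu' hv', hDι, map_mul, map_pow, map_pow, hpow j hj,
          Nat.add_sub_cancel' (Nat.lt_succ_iff.1 (Finset.mem_range.1 hj)), ← hσa]
        ring
      rw [Finset.sum_congr rfl h2, Finset.sum_add_distrib, ← Finset.mul_sum, ← Finset.mul_sum,
        hBsum, mul_zero, zero_add] at h1
      exact (mul_eq_zero.1 h1).resolve_left (mul_ne_zero (pow_ne_zero _ hv) ha)
    -- Eliminating the top coefficient between `B` and its differentiated form gives a relation for
    -- `ρ` of degree below `m`, so by minimality every coefficient of `R` vanishes under `σ`.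
    set R : A'[X] := ∑ j ∈ Finset.range m,
      monomial j (B.leadingCoeff * D' (B.coeff j) - B.coeff j * D' B.leadingCoeff) with hR
    have hRdeg : R.natDegree < m := by
      have : R.natDegree ≤ m - 1 := natDegree_sum_le_of_forall_le _ _ fun j hj =>
        (natDegree_monomial_le _).trans (by have := Finset.mem_range.1 hj; omega)
      omega
    have hR0 : R.eval₂ σ ρ = 0 := by
      have h1 : ∑ j ∈ Finset.range (m + 1), (σ B.leadingCoeff * (σ (D' (B.coeff j)) * ρ ^ j) -
          σ (D' B.leadingCoeff) * (σ (B.coeff j) * ρ ^ j)) = 0 := by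
        rw [Finset.sum_sub_distrib, ← Finset.mul_sum, ← Finset.mul_sum, hDsum, hBsum]; ring
      rw [Finset.sum_range_succ] at h1
      have h2 : σ B.leadingCoeff * (σ (D' (B.coeff m)) * ρ ^ m) -
          σ (D' B.leadingCoeff) * (σ (B.coeff m) * ρ ^ m) = 0 := by
        simp only [leadingCoeff, ← hm]; ring
      rw [h2, add_zero] at h1
      rw [hR, eval₂_finsetSum, ← h1]
      refine Finset.sum_congr rfl fun j _ => ?_
      rw [eval₂_monomial, map_sub, map_mul, map_mul]; ring
    have hcoefR := hBmin R hR0 hRdeg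
    rcases lt_or_ge i m with hi | hi
    · have h1 := congrArg (fun p => coeff p i) hcoefR
      simp only [coeff_map, coeff_zero, hR, finsetSum_coeff, coeff_monomial,
        Finset.sum_ite_eq', Finset.mem_range, if_pos hi] at h1
      rwa [map_sub, map_mul, map_mul, sub_eq_zero] at h1
    · rcases eq_or_lt_of_le hi with rfl | hi
      · rw [← hm] at *; rfl
      · have hz : B.coeff i = 0 := coeff_eq_zero_of_natDegree_lt hi
        rw [hz, map_zero, hpres 0 (map_zero _)]; ring
  choose c hc using hcoef
  -- After division by the leading coefficient, `ρ` is a root of a polynomial over `ℂ`, which is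
  -- algebraically closed.
  have hroot : (∑ j ∈ Finset.range (m + 1), monomial j (c j)).eval₂
      (κ.comp (algebraMap ℂ A)) ρ = 0 := by
    have h1 : σ B.leadingCoeff * (∑ j ∈ Finset.range (m + 1), monomial j (c j)).eval₂
        (κ.comp (algebraMap ℂ A)) ρ = 0 := by
      rw [← hB0, eval₂_finsetSum, eval₂_eq_sum_range, Finset.mul_sum]
      refine Finset.sum_congr rfl fun j _ => ?_
      rw [eval₂_monomial, hc j, hσa (algebraMap ℂ A' (c j)), hιc]
      change σ _ * (κ (algebraMap ℂ A (c j)) * ρ ^ j) = _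
      ring
    exact (mul_eq_zero.1 h1).resolve_left hBlc
  obtain ⟨k, hk⟩ := exists_eq_of_eval₂_eq_zero _ (fun h => by
    have h1 := congrArg (fun p => coeff p m) h
    simp only [finsetSum_coeff, coeff_monomial, Finset.sum_ite_eq', Finset.mem_range,
      Nat.lt_succ_self, if_true, coeff_zero] at h1
    have h2 := hc m
    rw [h1, map_zero, map_zero, zero_mul] at h2
    exact hBlc h2) hroot
  exact ⟨k, by rw [hu, hk]; rfl⟩

end ConstantFields

/-! ### Constancy along an ultrafilter of holomorphic germs. -/

section HolomorphicConstants

open Metric Filter Topology Polynomial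

universe u

variable {E E' : Type u} [NormedAddCommGroup E] [NormedSpace ℂ E]
  [NormedAddCommGroup E'] [NormedSpace ℂ E']

/-- Let `𝓕` be a filter at the origin. If a quotient `u / v` of holomorphic functions is killed by
all holomorphic vector fields tangent to `𝓕`, then it is constant along `𝓕`. -/
def ConstantsTrivialAlong (𝓕 : Filter E) : Prop :=
  ∀ u v : E → ℂ, HolomorphicNearZero u → HolomorphicNearZero v → (¬ ∀ᶠ x in 𝓕, v x = 0) →
    (∀ c : E → E, HolomorphicNearZero c →
      (∀ φ : E → ℂ, HolomorphicNearZero φ → (∀ᶠ x in 𝓕, φ x = 0) →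
        ∀ᶠ x in 𝓕, fderiv ℂ φ x (c x) = 0) →
      ∀ᶠ x in 𝓕, v x * fderiv ℂ u x (c x) = u x * fderiv ℂ v x (c x)) →
    ∃ k : ℂ, ∀ᶠ x in 𝓕, u x = k * v x

/-- The identity theorem along a complex line. -/
theorem eq_zero_of_eventually_line {s : Set E} (hs : IsOpen s) (hc : Convex ℝ s) {φ : E → ℂ}
    (hφ : DifferentiableOn ℂ φ s) {x₀ y : E} (hx₀ : x₀ ∈ s) (hy : y ∈ s)
    (h : ∀ᶠ t in 𝓝 (0 : ℂ), φ (x₀ + t • (y - x₀)) = 0) : φ y = 0 := by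
  let l : ℂ → E := fun t => x₀ + t • (y - x₀)
  have hl : Differentiable ℂ l := by fun_prop
  have hopen : IsOpen (l ⁻¹' s) := hs.preimage hl.continuous
  have hconv : Convex ℝ (l ⁻¹' s) := by
    intro a ha b hb α β hα hβ hαβ
    have : l (α • a + β • b) = α • l a + β • l b := by
      have h1 : x₀ = α • x₀ + β • x₀ := by rw [← add_smul, hαβ, one_smul]
      simp only [l, smul_add, add_smul, smul_assoc]
      nth_rewrite 1 [h1]
      abel
    change l _ ∈ s
    rw [this]
    exact hc ha hb hα hβ hαβ
  have hd : DifferentiableOn ℂ (φ ∘ l) (l ⁻¹' s) := hφ.comp hl.differentiableOn fun _ h => h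
  have h0 : (0 : ℂ) ∈ l ⁻¹' s := by simpa [l] using hx₀
  have h1 : (1 : ℂ) ∈ l ⁻¹' s := by simpa [l] using hy
  have := (hd.analyticOnNhd hopen).eqOn_zero_of_preconnected_of_eventuallyEq_zero
    hconv.isPreconnected h0 h h1
  simpa [l] using this

/-- The case in which no nonzero germ vanishes along `𝓕`. -/
theorem ConstantsTrivialAlong.of_forall_eventually_zero [FiniteDimensional ℂ E] {𝓕 : Filter E}
    (h𝓕 : 𝓕 ≤ 𝓝 0)
    (h : ∀ φ : E → ℂ, HolomorphicNearZero φ → (∀ᶠ x in 𝓕, φ x = 0) → ∀ᶠ x in 𝓝 0, φ x = 0) :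
    ConstantsTrivialAlong 𝓕 := by
  intro u v hu hv hv0 H
  have hdir : ∀ w : E, ∀ᶠ x in 𝓝 (0 : E), v x * fderiv ℂ u x w - u x * fderiv ℂ v x w = 0 := by
    intro w
    refine h _ ?_ ?_
    · filter_upwards [hu, hv, hu.fderiv_apply_const w, hv.fderiv_apply_const w] with x h1 h2 h3 h4
      exact (h2.mul h3).sub (h1.mul h4)
    -- Every constant field qualifies: a function vanishing along `𝓕` vanishes near the origin, and
    -- so does its derivative.
    · have := H (fun _ => w) (Eventually.of_forall fun x => differentiableAt_const w) ?_
      · filter_upwards [this] with x hx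
        rw [hx, sub_self]
      · intro φ hφ hφ0
        have := (h φ hφ hφ0).eventually_nhds
        refine h𝓕 ?_
        filter_upwards [this] with x hx
        have h0 : φ =ᶠ[𝓝 x] fun _ => 0 := hx
        rw [h0.fderiv_eq]
        simp
  let b := Module.finBasis ℂ E
  have hall : ∀ᶠ x in 𝓝 (0 : E), v x • fderiv ℂ u x = u x • fderiv ℂ v x := by
    filter_upwards [(eventually_all (ι := Fin (Module.finrank ℂ E))).2 fun i => hdir (b i)]
      with x hx
    apply ContinuousLinearMap.coe_injective
    refine b.ext fun i => ?_
    simpa [sub_eq_zero] using hx i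
  obtain ⟨r, hr, hball⟩ := Metric.mem_nhds_iff.1 ((hu.and hv).and hall)
  obtain ⟨x₀, hvx₀, hx₀⟩ : ∃ x, v x ≠ 0 ∧ x ∈ ball (0 : E) r := by
    have : ∃ᶠ x in 𝓝 (0 : E), v x ≠ 0 := fun hcon => hv0 (h𝓕 (hcon.mono fun x hx => not_not.1 hx))
    exact (this.and_eventually (ball_mem_nhds (0 : E) hr)).exists
  set k := u x₀ / v x₀ with hk
  have hud : DifferentiableOn ℂ u (ball 0 r) := fun x hx =>
    (hball hx).1.1.differentiableWithinAt
  have hvd : DifferentiableOn ℂ v (ball 0 r) := fun x hx =>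
    (hball hx).1.2.differentiableWithinAt
  have hloc : ∀ᶠ x in 𝓝 x₀, u x - k * v x = 0 := by
    have hev : ∀ᶠ x in 𝓝 x₀, v x ≠ 0 ∧ x ∈ ball (0 : E) r :=
      ((hball hx₀).1.2.continuousAt.eventually_ne hvx₀).and (isOpen_ball.mem_nhds hx₀)
    obtain ⟨δ, hδ, hδs⟩ := Metric.mem_nhds_iff.1 hev
    have hq : ∀ x ∈ ball x₀ δ, HasFDerivAt (fun x => u x * (v x)⁻¹) (0 : E →L[ℂ] ℂ) x := by
      intro x hx
      have h1 := (hball (hδs hx).2).1.1.hasFDerivAt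
      have h2 := (hball (hδs hx).2).1.2.hasFDerivAt
      have h3 := (hball (hδs hx).2).2
      have h4 := h1.mul ((hasDerivAt_inv (hδs hx).1).comp_hasFDerivAt x h2)
      convert! h4 using 1
      ext w
      have h5 := congrArg (fun f : E →L[ℂ] ℂ => f w) h3
      simp only [smul_apply, smul_eq_mul] at h5
      have hvx := (hδs hx).1
      simp only [zero_apply, add_apply,
        smul_apply, smul_eq_mul, Function.comp]
      field_simp
      linear_combination -h5
    filter_upwards [ball_mem_nhds x₀ hδ] with x hx
    have hconst := isOpen_ball.is_const_of_fderiv_eq_zero (𝕜 := ℂ)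
      (convex_ball x₀ δ).isPreconnected
      (fun y hy => (hq y hy).differentiableAt.differentiableWithinAt)
      (fun y hy => (hq y hy).fderiv) hx (mem_ball_self hδ)
    have hvx := (hδs hx).1
    have : u x = k * v x := by
      rw [hk, div_eq_mul_inv, ← hconst, mul_assoc, inv_mul_cancel₀ hvx, mul_one]
    rw [this, sub_self]
  refine ⟨k, h𝓕 ?_⟩
  filter_upwards [ball_mem_nhds (0 : E) hr] with y hy
  have hline : Tendsto (fun t : ℂ => x₀ + t • (y - x₀)) (𝓝 0) (𝓝 x₀) := by
    have : Continuous fun t : ℂ => x₀ + t • (y - x₀) := by fun_prop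
    simpa using this.tendsto 0
  have := eq_zero_of_eventually_line isOpen_ball (convex_ball 0 r)
    (φ := fun x => u x - k * v x) (hud.sub (hvd.const_mul k)) hx₀ hy (hline.eventually hloc)
  exact sub_eq_zero.1 this

theorem ConstantsTrivialAlong.of_equiv {𝓕 : Filter E} (e : E ≃L[ℂ] E')
    (h : ConstantsTrivialAlong (𝓕.map e)) : ConstantsTrivialAlong 𝓕 := by
  intro u v hu hv hv0 H
  have hpull : ∀ {φ : E → ℂ}, HolomorphicNearZero φ → HolomorphicNearZero fun y => φ (e.symm y) :=
    fun hφ => hφ.comp_differentiable e.symm.differentiable (map_zero _)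
  have hfd : ∀ (φ : E → ℂ) (x w), fderiv ℂ (fun y => φ (e.symm y)) (e x) w =
      fderiv ℂ φ x (e.symm w) := by
    intro φ x w
    have := e.symm.comp_right_fderiv (f := φ) (x := e x)
    have h2 := congrArg (fun f : E' →L[ℂ] ℂ => f w) this
    simpa [Function.comp_def] using h2
  obtain ⟨k, hk⟩ := h _ _ (hpull hu) (hpull hv) (by simpa [eventually_map] using hv0) (by
    intro c hc hpres
    have hc' : HolomorphicNearZero fun x => e.symm (c (e x)) := by
      have := hc.comp_differentiable (c := fun x => e x) e.differentiable (map_zero _)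
      filter_upwards [this] with x hx
      exact e.symm.differentiableAt.comp x hx
    rw [eventually_map]
    simp only [hfd, ContinuousLinearEquiv.symm_apply_apply]
    refine H _ hc' fun φ hφ hφ0 => ?_
    have := hpres _ (hpull hφ) (by simpa [eventually_map] using hφ0)
    simpa only [eventually_map, hfd] using this)
  exact ⟨k, by simpa [eventually_map] using hk⟩

variable (E) in
/-- The algebra of functions which are holomorphic near the origin. -/
def holomorphicAlgebra : Subalgebra ℂ (E → ℂ) where
  carrier := {φ | HolomorphicNearZero φ}
  mul_mem' := fun ha hb => by
    filter_upwards [ha, hb] with x h1 h2 using h1.mul h2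
  add_mem' := fun ha hb => by
    filter_upwards [ha, hb] with x h1 h2 using h1.add h2
  algebraMap_mem' := fun r => Eventually.of_forall fun _ => differentiableAt_const r

variable (E) in
/-- The operators on functions given by vector fields which are holomorphic near the origin. -/
def vectorFields : Set (holomorphicAlgebra E → holomorphicAlgebra E) :=
  {D | ∃ c : E → E, HolomorphicNearZero c ∧
    ∀ (φ : holomorphicAlgebra E) (x : E), (D φ : E → ℂ) x = fderiv ℂ φ x (c x)}

theorem exists_vectorField [FiniteDimensional ℂ E] {c : E → E} (hc : HolomorphicNearZero c) :
    ∃ D ∈ vectorFields E, ∀ (φ : holomorphicAlgebra E) (x : E),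
      (D φ : E → ℂ) x = fderiv ℂ φ x (c x) :=
  ⟨fun φ => ⟨fun x => fderiv ℂ (φ : E → ℂ) x (c x), φ.2.fderiv_apply hc⟩, ⟨c, hc, fun _ _ => rfl⟩,
    fun _ _ => rfl⟩

section

variable {L : Type*} [Field L] {κ : holomorphicAlgebra E →+* L} {𝓕 : Filter E}

theorem map_eq_map_iff (hκ : ∀ φ, κ φ = 0 ↔ ∀ᶠ x in 𝓕, (φ : E → ℂ) x = 0)
    (φ ψ : holomorphicAlgebra E) : κ φ = κ ψ ↔ ∀ᶠ x in 𝓕, (φ : E → ℂ) x = (ψ : E → ℂ) x := by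
  rw [← sub_eq_zero, ← map_sub, hκ]
  simp [sub_eq_zero]

/-- The dictionary between the analytic statement and the algebraic one: the kernel of `κ` is the
ideal of functions vanishing along `𝓕`. -/
theorem constantsTrivial_iff [FiniteDimensional ℂ E]
    (hκ : ∀ φ, κ φ = 0 ↔ ∀ᶠ x in 𝓕, (φ : E → ℂ) x = 0) :
    ConstantsTrivial κ (vectorFields E) ↔ ConstantsTrivialAlong 𝓕 := by
  constructor
  · intro h u v hu hv hv0 H
    obtain ⟨k, hk⟩ := h ⟨u, hu⟩ ⟨v, hv⟩ (by rwa [Ne, hκ]) (by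
      rintro D ⟨c, hc, hD⟩ hpres
      rw [← map_mul, ← map_mul, map_eq_map_iff hκ]
      have := H c hc fun φ hφ hφ0 => by
        simpa [hD] using (hκ _).1 (hpres ⟨φ, hφ⟩ ((hκ _).2 hφ0))
      simpa [hD] using this)
    rw [← map_mul, map_eq_map_iff hκ] at hk
    exact ⟨k, hk⟩
  · intro h u v hv H
    obtain ⟨k, hk⟩ := h u v u.2 v.2 (by rwa [← hκ]) (by
      intro c hc hpres
      obtain ⟨D, hDm, hD⟩ := exists_vectorField hc
      have := H D hDm fun φ hφ => by
        rw [hκ]; simpa [hD] using hpres φ φ.2 ((hκ _).1 hφ)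
      rw [← map_mul, ← map_mul, map_eq_map_iff hκ] at this
      simpa [hD] using this)
    refine ⟨k, ?_⟩
    rw [← map_mul, map_eq_map_iff hκ]
    exact hk

/-- Functions in the algebra are differentiable only near the origin, so the sum and product rules
hold only eventually; after applying `κ` they become identities. -/
theorem isDerivationAlong_of_mem_vectorFields (h𝓕 : 𝓕 ≤ 𝓝 0)
    (hκ : ∀ φ, κ φ = 0 ↔ ∀ᶠ x in 𝓕, (φ : E → ℂ) x = 0) {D} (hD : D ∈ vectorFields E) :
    IsDerivationAlong κ D := by
  obtain ⟨c, hc, hD⟩ := hD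
  constructor
  · intro φ ψ
    rw [← map_add, map_eq_map_iff hκ]
    filter_upwards [h𝓕 φ.2, h𝓕 ψ.2] with x h1 h2
    simp only [hD, Subalgebra.coe_add, Pi.add_apply]
    rw [fderiv_add h1 h2]; rfl
  · intro φ ψ
    rw [← map_mul, ← map_mul, ← map_add, map_eq_map_iff hκ]
    filter_upwards [h𝓕 φ.2, h𝓕 ψ.2] with x h1 h2
    simp only [hD, Subalgebra.coe_add, Subalgebra.coe_mul, Pi.add_apply, Pi.mul_apply]
    rw [fderiv_mul h1 h2]; rfl

/-- Agreement on a full neighbourhood of the origin passes to derivatives, whereas agreement along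
`𝓕` alone need not. -/
theorem map_vectorField_congr (h𝓕 : 𝓕 ≤ 𝓝 0)
    (hκ : ∀ φ, κ φ = 0 ↔ ∀ᶠ x in 𝓕, (φ : E → ℂ) x = 0) {φ ψ : holomorphicAlgebra E}
    (h : ∀ᶠ x in 𝓝 0, (φ : E → ℂ) x = (ψ : E → ℂ) x) :
    κ φ = κ ψ ∧ ∀ D ∈ vectorFields E, κ (D φ) = κ (D ψ) := by
  refine ⟨(map_eq_map_iff hκ _ _).2 (h𝓕 h), ?_⟩
  rintro D ⟨c, hc, hD⟩
  rw [map_eq_map_iff hκ]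
  filter_upwards [h𝓕 h.eventually_nhds] with x hx
  rw [hD, hD, Filter.EventuallyEq.fderiv_eq hx]

end

/-- Pull-back of functions along the first projection. -/
def pullbackFst : holomorphicAlgebra E' →+* holomorphicAlgebra (E' × ℂ) where
  toFun φ := ⟨fun p => (φ : E' → ℂ) p.1, φ.2.comp_differentiable differentiable_fst rfl⟩
  map_one' := rfl
  map_mul' _ _ := rfl
  map_zero' := rfl
  map_add' _ _ := rfl

/-- The last coordinate. -/
def lastCoord : holomorphicAlgebra (E' × ℂ) :=
  ⟨Prod.snd, Eventually.of_forall fun _ => differentiableAt_snd⟩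

theorem eval₂_pullbackFst_sum (d : ℕ) (a : ℕ → holomorphicAlgebra E') (p : E' × ℂ) :
    (((∑ k ∈ Finset.range d, monomial k (a k)).eval₂ pullbackFst lastCoord :
      holomorphicAlgebra (E' × ℂ)) : E' × ℂ → ℂ) p =
      ∑ k ∈ Finset.range d, (a k : E' → ℂ) p.1 * p.2 ^ k := by
  rw [eval₂_finsetSum]
  simp only [eval₂_monomial, AddSubmonoidClass.coe_finsetSum, Finset.sum_apply,
    Subalgebra.coe_mul, Subalgebra.coe_pow, Pi.mul_apply, Pi.pow_apply]
  rfl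

theorem monic_X_pow_sub_sum_monomial {R : Type*} [CommRing R] (d : ℕ) (a : ℕ → R) :
    (X ^ d - ∑ k ∈ Finset.range d, monomial k (a k) : R[X]).Monic :=
  monic_X_pow_sub <| mem_degreeLT.1 <| Submodule.sum_mem _ fun k hk => mem_degreeLT.2 <|
    (degree_monomial_le _ _).trans_lt (by exact_mod_cast Finset.mem_range.1 hk)

/-- The inductive step: a germ vanishing along `𝓤` which is regular in the last coordinate allows
us to eliminate that coordinate. -/
theorem ConstantsTrivialAlong.of_regular [FiniteDimensional ℂ E'] (𝓤 : Ultrafilter (E' × ℂ))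
    (h𝓤 : (𝓤 : Filter (E' × ℂ)) ≤ 𝓝 0)
    {g : E' × ℂ → ℂ} (hg : HolomorphicNearZero g) (hg0 : ∀ᶠ p in (𝓤 : Filter (E' × ℂ)), g p = 0)
    (hreg : ¬ ∀ᶠ t in 𝓝 (0 : ℂ), g (0, t) = 0)
    (h : ConstantsTrivialAlong ((𝓤 : Filter (E' × ℂ)).map Prod.fst)) :
    ConstantsTrivialAlong (𝓤 : Filter (E' × ℂ)) := by
  -- Germs along an ultrafilter form a field, so this map has prime kernel and can serve as the map
  -- into `L`.
  let κ : holomorphicAlgebra (E' × ℂ) →+* Germ (𝓤 : Filter (E' × ℂ)) ℂ :=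
    (Germ.coeRingHom (𝓤 : Filter (E' × ℂ))).comp (holomorphicAlgebra (E' × ℂ)).val.toRingHom
  have hκ : ∀ φ, κ φ = 0 ↔ ∀ᶠ p in (𝓤 : Filter (E' × ℂ)), (φ : E' × ℂ → ℂ) p = 0 :=
    fun φ => Germ.coe_eq
  rw [← constantsTrivial_iff hκ]
  have hfst : Tendsto (Prod.fst : E' × ℂ → E') (𝓝 0) (𝓝 0) := continuous_fst.tendsto (0 : E' × ℂ)
  have hκ' : ∀ φ, (κ.comp pullbackFst) φ = 0 ↔
      ∀ᶠ x in (𝓤 : Filter (E' × ℂ)).map Prod.fst, (φ : E' → ℂ) x = 0 := fun φ => hκ _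
  obtain ⟨d, hdiv⟩ := weierstrass_division hg hreg
  -- Dividing `t ^ d` by `g` yields a monic polynomial `w` in `t` that is a multiple of `g`, so it
  -- vanishes along `𝓤`.
  obtain ⟨q, a, hq, ha, hqa⟩ := hdiv (fun p => p.2 ^ d)
    (Eventually.of_forall fun p => by fun_prop)
  let a' : ℕ → holomorphicAlgebra E' := fun k => ⟨a k, ha k⟩
  set w : (holomorphicAlgebra E')[X] :=
    X ^ d - ∑ k ∈ Finset.range d, monomial k (a' k) with hw
  have hmonic : w.Monic := monic_X_pow_sub_sum_monomial _ _
  have hwev : ∀ p : E' × ℂ, ((w.eval₂ pullbackFst lastCoord : holomorphicAlgebra (E' × ℂ)) :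
      E' × ℂ → ℂ) p = p.2 ^ d - ∑ k ∈ Finset.range d, a k p.1 * p.2 ^ k := by
    intro p
    have := eval₂_pullbackFst_sum d a' p
    rw [hw, eval₂_sub, eval₂_X_pow, Subalgebra.coe_sub, Pi.sub_apply, this]
    rfl
  -- Restricted to the axis, `w` is a monic polynomial, so it is not identically zero. One can
  -- therefore divide by `w` itself and reduce every function to a polynomial in `t`.
  have hwreg : ¬ ∀ᶠ t in 𝓝 (0 : ℂ),
      ((w.eval₂ pullbackFst lastCoord : holomorphicAlgebra (E' × ℂ)) : E' × ℂ → ℂ) (0, t) = 0 := by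
    intro hcon
    let W : ℂ[X] := X ^ d - ∑ k ∈ Finset.range d, monomial k (a k 0)
    have hW : W.Monic := monic_X_pow_sub_sum_monomial _ _
    refine hW.ne_zero (eq_zero_of_infinite_isRoot _ (infinite_of_mem_nhds 0 ?_))
    filter_upwards [hcon] with t ht
    rw [hwev] at ht
    simpa [W, IsRoot, eval_finsetSum, eval_monomial] using ht
  obtain ⟨d₂, hdiv₂⟩ := weierstrass_division (w.eval₂ pullbackFst lastCoord).2 hwreg
  refine ConstantsTrivial.of_integral_generator (ι := pullbackFst) (t := lastCoord)
    (𝒟' := vectorFields E') (fun c => rfl)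
    (fun D hD => isDerivationAlong_of_mem_vectorFields h𝓤 hκ hD)
    ((constantsTrivial_iff hκ').2 h) ?_ hmonic ?_ ?_
  · rintro D' ⟨c', hc', hD'⟩ α β
    have hc : HolomorphicNearZero fun p : E' × ℂ =>
        ((α : E' × ℂ → ℂ) p • c' p.1, (β : E' × ℂ → ℂ) p) := by
      filter_upwards [α.2, β.2, hfst.eventually hc'] with p h1 h2 h3
      exact (h1.smul (h3.comp p differentiableAt_fst)).prodMk h2
    obtain ⟨D, hDm, hD⟩ := exists_vectorField hc
    refine ⟨D, hDm, fun φ => ?_, ?_⟩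
    · rw [← map_mul, map_eq_map_iff hκ]
      filter_upwards [h𝓤 (hfst.eventually φ.2)] with p hp
      rw [hD]
      have hcomp : HasFDerivAt (fun p : E' × ℂ => (φ : E' → ℂ) p.1)
          ((fderiv ℂ (φ : E' → ℂ) p.1).comp (ContinuousLinearMap.fst ℂ E' ℂ)) p :=
        hp.hasFDerivAt.comp p hasFDerivAt_fst
      have hco : ((pullbackFst φ : holomorphicAlgebra (E' × ℂ)) : E' × ℂ → ℂ) =
        fun p => (φ : E' → ℂ) p.1 := rfl
      rw [hco, hcomp.fderiv]
      have hpd : ((pullbackFst (D' φ) : holomorphicAlgebra (E' × ℂ)) : E' × ℂ → ℂ) p =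
        (D' φ : E' → ℂ) p.1 := rfl
      rw [Subalgebra.coe_mul, Pi.mul_apply, hpd, hD']
      simp
    · rw [map_eq_map_iff hκ]
      refine Eventually.of_forall fun p => ?_
      rw [hD]
      have hco : ((lastCoord : holomorphicAlgebra (E' × ℂ)) : E' × ℂ → ℂ) = Prod.snd := rfl
      rw [hco, fderiv_snd]
      rfl
  · rw [hκ]
    filter_upwards [h𝓤 hqa, hg0] with p h1 h2
    rw [hwev, h1, h2]; ring
  · intro φ
    obtain ⟨q₂, a₂, hq₂, ha₂, hqa₂⟩ := hdiv₂ φ φ.2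
    refine ⟨⟨q₂, hq₂⟩, ∑ k ∈ Finset.range d₂, monomial k ⟨a₂ k, ha₂ k⟩,
      map_vectorField_congr h𝓤 hκ ?_⟩
    filter_upwards [hqa₂] with p hp
    rw [Subalgebra.coe_add, Pi.add_apply, eval₂_pullbackFst_sum, hp]
    rfl

/-- Quotients of holomorphic functions which are constant along all holomorphic vector fields
tangent to an ultrafilter at the origin are constant along that ultrafilter. -/
theorem constantsTrivialAlong_ultrafilter [FiniteDimensional ℂ E] (𝓤 : Ultrafilter E)
    (h𝓤 : (𝓤 : Filter E) ≤ 𝓝 0) :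
    ConstantsTrivialAlong (𝓤 : Filter E) := by
  induction hn : Module.finrank ℂ E using Nat.strong_induction_on generalizing E with
  | _ n ih =>
  by_cases hzero : ∀ φ : E → ℂ, HolomorphicNearZero φ → (∀ᶠ x in (𝓤 : Filter E), φ x = 0) →
      ∀ᶠ x in 𝓝 0, φ x = 0
  · exact ConstantsTrivialAlong.of_forall_eventually_zero h𝓤 hzero
  push Not at hzero
  obtain ⟨g, hg, hg0, hgne⟩ := hzero
  have hg00 : g 0 = 0 :=
    tendsto_nhds_unique ((hg.self_of_nhds.continuousAt.tendsto.mono_left h𝓤))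
      (tendsto_const_nhds.congr' (hg0.mono fun x hx => hx.symm))
  -- A germ vanishing on every line through the origin is zero by the identity theorem. A line where
  -- `g` is nonzero becomes the last coordinate axis.
  obtain ⟨e, he⟩ : ∃ e : E, ¬ ∀ᶠ t in 𝓝 (0 : ℂ), g (t • e) = 0 := by
    by_contra hcon
    push Not at hcon
    obtain ⟨r, hr, hball⟩ := Metric.mem_nhds_iff.1 hg
    obtain ⟨y, hy, hyb⟩ := (hgne.and_eventually (ball_mem_nhds (0 : E) hr)).exists
    refine hy (eq_zero_of_eventually_line isOpen_ball (convex_ball 0 r)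
      (fun x hx => (hball hx).differentiableWithinAt) (mem_ball_self hr) hyb ?_)
    simpa using hcon y
  have he0 : e ≠ 0 := by
    rintro rfl
    exact he (Eventually.of_forall fun t => by rw [smul_zero, hg00])
  obtain ⟨E', hE'⟩ := (Submodule.span ℂ {e}).exists_isCompl
  let l : (E' × ℂ) ≃L[ℂ] E :=
    ((LinearEquiv.prodCongr (LinearEquiv.refl ℂ E')
      (LinearEquiv.toSpanNonzeroSingleton ℂ E e he0)).trans
      (Submodule.prodEquivOfIsCompl E' (Submodule.span ℂ {e}) hE'.symm)).toContinuousLinearEquiv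
  have hl : ∀ t : ℂ, l (0, t) = t • e := fun t => by
    simp [l, LinearEquiv.toSpanNonzeroSingleton_apply]
  have hrank : Module.finrank ℂ E' < n := by
    have := l.toLinearEquiv.finrank_eq
    rw [Module.finrank_prod, Module.finrank_self] at this
    omega
  refine ConstantsTrivialAlong.of_equiv l.symm ?_
  have hmap : Tendsto l.symm (𝓤 : Filter E) (𝓝 0) := by
    have := (l.symm.continuous.tendsto 0).mono_left h𝓤
    simpa using this
  refine ConstantsTrivialAlong.of_regular (𝓤.map l.symm) hmap
    (g := fun p => g (l p)) (hg.comp_differentiable l.differentiable (map_zero _)) ?_ ?_ ?_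
  · rw [Ultrafilter.coe_map, eventually_map]
    simpa using hg0
  · simpa only [hl] using he
  · have hfst : Tendsto (Prod.fst : E' × ℂ → E') (𝓝 0) (𝓝 0) :=
      continuous_fst.tendsto (0 : E' × ℂ)
    exact ih _ hrank ((𝓤.map l.symm).map Prod.fst) (hfst.comp hmap) rfl

end HolomorphicConstants

/-! ### Transversality of the zero set to small spheres. -/

section Transversality

open Metric Filter Topology

theorem fderiv_apply_eq_sum {m : ℕ} (f : EuclideanSpace ℂ (Fin m) → ℂ)
    (z v : EuclideanSpace ℂ (Fin m)) :
    fderiv ℂ f z v = ∑ j, v j * conj (conjGrad f z j) := by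
  have h : v = ∑ j, v j • EuclideanSpace.single j (1 : ℂ) := by
    ext i
    simp [Pi.single_apply]
  conv_lhs => rw [h]
  simp [conjGrad]

/-- Near the origin, the zero set of a holomorphic function is transverse to all spheres centred at
the origin, away from the origin. -/
theorem eventually_ne_smul_conjGrad {m : ℕ} {f : EuclideanSpace ℂ (Fin m) → ℂ}
    (hf : HolomorphicNearZero f) :
    ∀ᶠ z in 𝓝 (0 : EuclideanSpace ℂ (Fin m)), f z = 0 → z ≠ 0 → ∀ μ : ℂ, z ≠ μ • conjGrad f z := by
  by_contra hcon
  have hfreq : ∃ᶠ z in 𝓝 (0 : EuclideanSpace ℂ (Fin m)),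
      f z = 0 ∧ z ≠ 0 ∧ ∃ μ : ℂ, z = μ • conjGrad f z := by
    refine fun h => hcon (h.mono fun z hz h1 h2 μ h3 => hz ⟨h1, h2, μ, h3⟩)
  rw [frequently_iff_neBot] at hfreq
  let 𝓥 := Ultrafilter.of (𝓝 (0 : EuclideanSpace ℂ (Fin m)) ⊓
    𝓟 {z | f z = 0 ∧ z ≠ 0 ∧ ∃ μ : ℂ, z = μ • conjGrad f z})
  have h𝓥 := Ultrafilter.of_le (𝓝 (0 : EuclideanSpace ℂ (Fin m)) ⊓
    𝓟 {z | f z = 0 ∧ z ≠ 0 ∧ ∃ μ : ℂ, z = μ • conjGrad f z})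
  have h𝓥0 : (𝓥 : Filter (EuclideanSpace ℂ (Fin m))) ≤ 𝓝 0 := h𝓥.trans inf_le_left
  have h𝓥X : ∀ᶠ z in (𝓥 : Filter (EuclideanSpace ℂ (Fin m))),
      f z = 0 ∧ z ≠ 0 ∧ ∃ μ : ℂ, z = μ • conjGrad f z :=
    le_principal_iff.1 (h𝓥.trans inf_le_right)
  let e : (Fin m → ℂ) ≃L[ℂ] EuclideanSpace ℂ (Fin m) :=
    (PiLp.continuousLinearEquiv 2 ℂ fun _ : Fin m => ℂ).symm
  -- Treating `z` and its conjugate as independent variables turns `‖z‖²` into a holomorphic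
  -- function.
  let ν : EuclideanSpace ℂ (Fin m) → (Fin m → ℂ) × (Fin m → ℂ) :=
    fun z => (e.symm z, star (e.symm z))
  have hνc : Continuous ν := by
    have := e.symm.continuous
    exact this.prodMk this.star
  have hν0 : ν 0 = 0 := by simp [ν]
  have hνt : Tendsto ν (𝓥 : Filter (EuclideanSpace ℂ (Fin m))) (𝓝 0) := by
    have := (hνc.tendsto 0).mono_left h𝓥0
    rwa [hν0] at this
  let f₀ : (Fin m → ℂ) → ℂ := fun x => f (e x)
  have hf₀ : HolomorphicNearZero f₀ := hf.comp_differentiable e.differentiable (map_zero _)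
  have hf₁ : HolomorphicNearZero (star ∘ f₀ ∘ star) := by
    have hs : Tendsto (star : (Fin m → ℂ) → (Fin m → ℂ)) (𝓝 0) (𝓝 0) := by
      have : Continuous (star : (Fin m → ℂ) → (Fin m → ℂ)) := continuous_star
      simpa using this.tendsto 0
    filter_upwards [hs.eventually hf₀] with x hx
    have := hx.star_star
    rwa [star_star] at this
  have hF₁ := hf₀.comp_differentiable
    (c := (Prod.fst : (Fin m → ℂ) × (Fin m → ℂ) → Fin m → ℂ)) differentiable_fst rfl
  have hF₂ := hf₁.comp_differentiable
    (c := (Prod.snd : (Fin m → ℂ) × (Fin m → ℂ) → Fin m → ℂ)) differentiable_snd rfl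
  have hr : ∀ p : (Fin m → ℂ) × (Fin m → ℂ), HasFDerivAt
      (fun p : (Fin m → ℂ) × (Fin m → ℂ) => ∑ i, p.1 i * p.2 i)
      (∑ i, (p.1 i • ((ContinuousLinearMap.proj (R := ℂ) i).comp
        (ContinuousLinearMap.snd ℂ (Fin m → ℂ) (Fin m → ℂ))) +
        p.2 i • ((ContinuousLinearMap.proj (R := ℂ) i).comp
        (ContinuousLinearMap.fst ℂ (Fin m → ℂ) (Fin m → ℂ))))) p := by
    intro p
    refine HasFDerivAt.fun_sum fun i _ => ?_
    exact ((ContinuousLinearMap.proj (R := ℂ) i).comp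
        (ContinuousLinearMap.fst ℂ (Fin m → ℂ) (Fin m → ℂ))).hasFDerivAt.mul
      ((ContinuousLinearMap.proj (R := ℂ) i).comp
        (ContinuousLinearMap.snd ℂ (Fin m → ℂ) (Fin m → ℂ))).hasFDerivAt
  have hfe : ∀ x a, fderiv ℂ f₀ x a = fderiv ℂ f (e x) (e a) := by
    intro x a
    have := e.comp_right_fderiv (f := f) (x := x)
    exact congrArg (fun l : (Fin m → ℂ) →L[ℂ] ℂ => l a) this
  -- At a bad point `z` is proportional to the conjugated gradient, so vectors annihilated by `df`
  -- are Hermitian-orthogonal to `z`.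
  have tangent : ∀ z : EuclideanSpace ℂ (Fin m), (∃ μ : ℂ, z = μ • conjGrad f z) →
      ∀ v, fderiv ℂ f z v = 0 → ∑ i, v i * conj (z i) = 0 := by
    rintro z ⟨μ, hμ⟩ v hv
    rw [fderiv_apply_eq_sum] at hv
    have : ∀ i, conj (z i) = conj μ * conj (conjGrad f z i) := fun i => by
      conv_lhs => rw [hμ]
      simp
    simp_rw [this, mul_left_comm _ (conj μ)]
    rw [← Finset.mul_sum, hv, mul_zero]
  obtain ⟨k, hk⟩ := constantsTrivialAlong_ultrafilter (𝓥.map ν) hνt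
    (fun p => ∑ i, p.1 i * p.2 i) (fun _ => 1)
    (Eventually.of_forall fun p => (hr p).differentiableAt)
    (Eventually.of_forall fun p => differentiableAt_const _) (by
      rw [Ultrafilter.coe_map, eventually_map]
      simpa using 𝓥.neBot'.ne) (by
    intro c hc hpres
    have h₁ := hpres _ hF₁ (by
      rw [Ultrafilter.coe_map, eventually_map]
      filter_upwards [h𝓥X] with z hz
      simpa [f₀, ν] using hz.1)
    have h₂ := hpres _ hF₂ (by
      rw [Ultrafilter.coe_map, eventually_map]
      filter_upwards [h𝓥X] with z hz
      simpa [f₀, ν] using hz.1)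
    rw [Ultrafilter.coe_map, eventually_map] at *
    filter_upwards [h₁, h₂, h𝓥X, h𝓥0 hf] with z h₁ h₂ hz hzf
    have hd₀ : HasFDerivAt f₀ (fderiv ℂ f₀ (e.symm z)) (e.symm z) := by
      refine DifferentiableAt.hasFDerivAt ?_
      refine DifferentiableAt.comp (g := f) _ ?_ e.differentiableAt
      simpa using hzf
    have e₁ : HasFDerivAt (fun p : (Fin m → ℂ) × (Fin m → ℂ) => f₀ p.1)
        ((fderiv ℂ f₀ (e.symm z)).comp (ContinuousLinearMap.fst ℂ _ _)) (ν z) :=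
      HasFDerivAt.comp (g := f₀) (ν z) hd₀ hasFDerivAt_fst
    have e₂ := HasFDerivAt.comp (g := star ∘ f₀ ∘ star)
      (f := (Prod.snd : (Fin m → ℂ) × (Fin m → ℂ) → Fin m → ℂ)) (ν z) hd₀.star_star hasFDerivAt_snd
    have t₁ : fderiv ℂ f z (e (c (ν z)).1) = 0 := by
      rw [e₁.fderiv] at h₁
      simpa [hfe] using h₁
    have t₂ : fderiv ℂ f z (e (star (c (ν z)).2)) = 0 := by
      have h₂' := e₂.fderiv
      simp only [Function.comp_def] at h₂' h₂
      rw [h₂'] at h₂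
      simpa [hfe] using h₂
    -- Tangency to `f(x) = 0` handles the first component of the field, and tangency to `conj f(conj
    -- y) = 0` handles the conjugate of the second. Together they annihilate `∑ xᵢ yᵢ`.
    have s₁ := tangent z hz.2.2 _ t₁
    have s₂ := congrArg conj (tangent z hz.2.2 _ t₂)
    rw [(hr (ν z)).fderiv]
    simp only [map_sum, map_mul, Complex.conj_conj, map_zero] at s₂
    have hev : ∀ a i, e a i = a i := fun a i => rfl
    have hes : ∀ i, e.symm z i = z i := fun i => rfl
    simp only [hev, Pi.star_apply] at s₁ s₂
    have : ∑ i, ((c (ν z)).2 i * z i + (c (ν z)).1 i * conj (z i)) = 0 := by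
      rw [Finset.sum_add_distrib, s₁, add_zero, ← s₂]
      simp
    simp only [fderiv_const_apply, zero_apply, mul_zero, one_mul, sum_apply, add_apply, smul_apply,
      ContinuousLinearMap.comp_apply, ContinuousLinearMap.coe_fst', ContinuousLinearMap.coe_snd',
      ContinuousLinearMap.proj_apply, smul_eq_mul]
    rw [← this]
    refine Finset.sum_congr rfl fun i _ => ?_
    simp only [ν, hes, Pi.star_apply, RCLike.star_def]
    ring)
  rw [Ultrafilter.coe_map, eventually_map] at hk
  have hnorm : ∀ z : EuclideanSpace ℂ (Fin m),
      ∑ i, (ν z).1 i * (ν z).2 i = ((‖z‖ ^ 2 : ℝ) : ℂ) := by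
    intro z
    rw [EuclideanSpace.norm_sq_eq]
    push_cast
    refine Finset.sum_congr rfl fun i _ => ?_
    exact Complex.mul_conj' (z i)
  simp only [hnorm, mul_one] at hk
  have hlim : Tendsto (fun z : EuclideanSpace ℂ (Fin m) => ((‖z‖ ^ 2 : ℝ) : ℂ))
      (𝓥 : Filter (EuclideanSpace ℂ (Fin m))) (𝓝 0) := by
    have : Continuous fun z : EuclideanSpace ℂ (Fin m) => ((‖z‖ ^ 2 : ℝ) : ℂ) := by fun_prop
    have := (this.tendsto 0).mono_left h𝓥0
    simpa using this
  have hk0 : k = 0 :=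
    tendsto_nhds_unique (tendsto_const_nhds.congr' (hk.mono fun z hz => hz.symm)) hlim
  obtain ⟨z, hz, hzk⟩ := (h𝓥X.and hk).exists
  rw [hk0] at hzk
  exact hz.2.1 (by simpa using hzk)

end Transversality

/-! ### Level sets of submersions, tangent spaces and rank. -/

section LevelSets

open Filter Topology

variable {E F H : Type*} [NormedAddCommGroup E] [NormedSpace ℝ E]
  [NormedAddCommGroup F] [NormedSpace ℝ F] [NormedAddCommGroup H] [NormedSpace ℝ H]

/-- A surjective linear map can be completed to a linear isomorphism. -/
theorem exists_continuousLinearEquiv_prod [FiniteDimensional ℝ E] [FiniteDimensional ℝ H] {d : ℕ}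
    (A : E →L[ℝ] H) (hA : Function.Surjective A)
    (hdim : Module.finrank ℝ E = Module.finrank ℝ H + d) :
    ∃ (B : E →L[ℝ] EuclideanSpace ℝ (Fin d)) (L : E ≃L[ℝ] H × EuclideanSpace ℝ (Fin d)),
      (L : E →L[ℝ] H × EuclideanSpace ℝ (Fin d)) = A.prod B := by
  let A' : E →ₗ[ℝ] H := A.toLinearMap
  have hker : Module.finrank ℝ (LinearMap.ker A') =
      Module.finrank ℝ (EuclideanSpace ℝ (Fin d)) := by
    have h1 := LinearMap.finrank_range_add_finrank_ker A'
    rw [LinearMap.range_eq_top.2 hA, finrank_top, hdim] at h1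
    rw [finrank_euclideanSpace_fin]
    exact Nat.add_left_cancel h1
  obtain ⟨π, hπ⟩ := (LinearMap.ker A').subtype.exists_leftInverse_of_injective
    (Submodule.ker_subtype _)
  let i := LinearEquiv.ofFinrankEq _ _ hker
  let B : E →ₗ[ℝ] EuclideanSpace ℝ (Fin d) := i.toLinearMap ∘ₗ π
  have hinj : Function.Injective (A'.prod B) := by
    rw [← LinearMap.ker_eq_bot, LinearMap.ker_eq_bot']
    intro v hv
    have h1 : A' v = 0 := congrArg Prod.fst hv
    have h2 : i (π v) = 0 := congrArg Prod.snd hv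
    have h3 : π v = ⟨v, h1⟩ := LinearMap.congr_fun hπ ⟨v, h1⟩
    rw [LinearEquiv.map_eq_zero_iff, h3] at h2
    exact congrArg Subtype.val h2
  refine ⟨LinearMap.toContinuousLinearMap B,
    (LinearMap.linearEquivOfInjective (A'.prod B) hinj (by
      rw [Module.finrank_prod, finrank_euclideanSpace_fin, hdim])).toContinuousLinearEquiv, ?_⟩
  ext1 v
  rfl

/-- A set which near `p` is a level set of a submersion has a local parametrization at `p`. -/
theorem exists_isLocalParametrization [FiniteDimensional ℝ E] [FiniteDimensional ℝ H] {d : ℕ}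
    {K N : Set E} {G : E → H} {c : H} (p : K) (hN : IsOpen N) (hpN : (p : E) ∈ N)
    (hG : ContDiffOn ℝ ∞ G N) (hK : ∀ z ∈ N, z ∈ K ↔ G z = c)
    (hsurj : Function.Surjective (fderiv ℝ G p))
    (hdim : Module.finrank ℝ E = Module.finrank ℝ H + d) :
    ∃ e : OpenPartialHomeomorph (EuclideanSpace ℝ (Fin d)) K,
      IsLocalParametrization e ∧ p ∈ e.target := by
  classical
  have : CompleteSpace E := FiniteDimensional.complete ℝ E
  obtain ⟨B, L, hL⟩ := exists_continuousLinearEquiv_prod _ hsurj hdim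
  -- Adding a linear complement `B` makes `(G, B)` a local diffeomorphism. The parametrization is `x
  -- ↦ Ψ⁻¹(c, x)`, with inverse `B`.
  let Ψ : E → H × EuclideanSpace ℝ (Fin d) := fun z => (G z, B z)
  have hΨ : ContDiffOn ℝ ∞ Ψ N := hG.prodMk B.contDiff.contDiffOn
  have hΨp : HasFDerivAt Ψ (L : E →L[ℝ] H × EuclideanSpace ℝ (Fin d)) p := by
    rw [hL]
    exact ((hG.contDiffAt (hN.mem_nhds hpN)).differentiableAt (by simp)).hasFDerivAt.prodMk
      B.hasFDerivAt
  have hequiv : ∀ᶠ z in 𝓝 (p : E), z ∈ N ∧ fderiv ℝ Ψ z ∈ Set.range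
      (ContinuousLinearEquiv.toContinuousLinearMap :
        (E ≃L[ℝ] H × EuclideanSpace ℝ (Fin d)) → _) := by
    refine (hN.eventually_mem hpN).and ?_
    have hc : ContinuousAt (fderiv ℝ Ψ) p :=
      (hΨ.continuousOn_fderiv_of_isOpen hN (by simp)).continuousAt (hN.mem_nhds hpN)
    refine hc ?_
    rw [hΨp.fderiv]
    exact ContinuousLinearEquiv.nhds L
  -- Shrinking to points where the derivative is invertible makes the inverse smooth on the whole
  -- target, not just at the image of `p`.
  obtain ⟨O, hO, hOo, hpO⟩ := eventually_nhds_iff.1 hequiv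
  let Φ := ((hΨ.contDiffAt (hN.mem_nhds hpN)).toOpenPartialHomeomorph Ψ hΨp
    (by simp)).restrOpen O hOo
  have hΦ : ∀ z, Φ z = Ψ z := fun z => rfl
  have hpΦ : (p : E) ∈ Φ.source :=
    ⟨(hΨ.contDiffAt (hN.mem_nhds hpN)).mem_toOpenPartialHomeomorph_source hΨp (by simp), hpO⟩
  have hΦO : Φ.source ⊆ O := fun z hz => hz.2
  have hsymm : ∀ y ∈ Φ.target, ContDiffAt ℝ ∞ Φ.symm y := by
    intro y hy
    obtain ⟨hz, L', hL'⟩ := hO _ (hΦO (Φ.map_target hy))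
    refine Φ.contDiffAt_symm (f₀' := L') hy ?_ (hΨ.contDiffAt (hN.mem_nhds hz))
    rw [hL']
    exact ((hΨ.contDiffAt (hN.mem_nhds hz)).differentiableAt (by simp)).hasFDerivAt
  have hmemK : ∀ x, (c, x) ∈ Φ.target → Φ.symm (c, x) ∈ K := fun x hx => by
    rw [hK _ (hO _ (hΦO (Φ.map_target hx))).1]
    exact congrArg Prod.fst (Φ.right_inv hx)
  have hBsymm : ∀ x, (c, x) ∈ Φ.target → B (Φ.symm (c, x)) = x := fun x hx =>
    congrArg Prod.snd (Φ.right_inv hx)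
  have hΦK : ∀ z : K, (z : E) ∈ Φ.source → Φ z = (c, B z) := fun z hz =>
    Prod.ext ((hK _ (hO _ (hΦO hz)).1).1 z.2) rfl
  let s : Set (EuclideanSpace ℝ (Fin d)) := {x | (c, x) ∈ Φ.target}
  have hs : IsOpen s := Φ.open_target.preimage (by fun_prop)
  let E₀ : EuclideanSpace ℝ (Fin d) → K := fun x =>
    if hx : (c, x) ∈ Φ.target then ⟨Φ.symm (c, x), hmemK x hx⟩ else p
  have hE₀ : ∀ x ∈ s, (E₀ x : E) = Φ.symm (c, x) := fun x hx => by
    have : (c, x) ∈ Φ.target := hx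
    simp [E₀, this]
  have hsmooth : ContDiffOn ℝ ∞ (fun x => (E₀ x : E)) s := by
    refine ContDiffOn.congr (fun x hx => ?_) hE₀
    refine (ContDiffAt.comp x (hsymm _ hx) (f := fun x => (c, x)) ?_).contDiffWithinAt
    exact contDiffAt_const.prodMk contDiffAt_id
  let e : OpenPartialHomeomorph (EuclideanSpace ℝ (Fin d)) K :=
    { toFun := E₀
      invFun := fun z => B z
      source := s
      target := {z | (z : E) ∈ Φ.source}
      map_source' := fun x hx => by
        change (E₀ x : E) ∈ Φ.source
        rw [hE₀ x hx]; exact Φ.map_target hx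
      map_target' := fun z hz => by
        change (c, B z) ∈ Φ.target
        rw [← hΦK z hz]; exact Φ.map_source hz
      left_inv' := fun x hx => by rw [hE₀ x hx, hBsymm x hx]
      right_inv' := fun z hz => by
        have h1 : B z ∈ s := by
          change (c, B z) ∈ Φ.target
          rw [← hΦK z hz]; exact Φ.map_source hz
        refine Subtype.ext ?_
        rw [hE₀ _ h1, ← hΦK z hz, Φ.left_inv hz]
      open_source := hs
      open_target := Φ.open_source.preimage continuous_subtype_val
      continuousOn_toFun := Topology.IsInducing.subtypeVal.continuousOn_iff.2 hsmooth.continuousOn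
      continuousOn_invFun := (B.continuous.comp continuous_subtype_val).continuousOn }
  refine ⟨e, ⟨hsmooth, fun x hx => ?_⟩, hpΦ⟩
  have hd : HasFDerivAt (fun y => (E₀ y : E)) (fderiv ℝ (fun y => (E₀ y : E)) x) x :=
    ((hsmooth.contDiffAt (hs.mem_nhds hx)).differentiableAt (by simp)).hasFDerivAt
  have hid : HasFDerivAt (fun y => B (E₀ y : E))
      (ContinuousLinearMap.id ℝ (EuclideanSpace ℝ (Fin d))) x := by
    refine (hasFDerivAt_id x).congr_of_eventuallyEq ?_
    filter_upwards [hs.mem_nhds hx] with y hy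
    rw [hE₀ y hy, hBsymm y hy]; rfl
  have hcomp := (B.hasFDerivAt.comp x hd).unique hid
  intro v w hvw
  have := fun v => congrArg (fun l => l v) hcomp
  simp only [ContinuousLinearMap.comp_apply, ContinuousLinearMap.id_apply] at this
  rw [← this v, ← this w]
  exact congrArg B hvw

/-- The image of the derivative of a local parametrization of a level set is the kernel of the
derivative of the defining map. -/
theorem IsLocalParametrization.range_fderiv [FiniteDimensional ℝ E] [FiniteDimensional ℝ H] {d : ℕ}
    {K : Set E} {e : OpenPartialHomeomorph (EuclideanSpace ℝ (Fin d)) K}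
    (he : IsLocalParametrization e) {G : E → H} {c : H} {A : E →L[ℝ] H}
    {x : EuclideanSpace ℝ (Fin d)} (hx : x ∈ e.source) (hA : HasFDerivAt G A (e x))
    (hK : ∀ z ∈ K, G z = c) (hsurj : Function.Surjective A)
    (hdim : Module.finrank ℝ E = Module.finrank ℝ H + d) :
    LinearMap.range (fderiv ℝ (fun y => (e y : E)) x : EuclideanSpace ℝ (Fin d) →ₗ[ℝ] E) =
      LinearMap.ker (A : E →ₗ[ℝ] H) := by
  have hd := ((he.contDiffOn.contDiffAt (e.open_source.mem_nhds hx)).differentiableAt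
    (by simp)).hasFDerivAt
  have hcomp : A.comp (fderiv ℝ (fun y => (e y : E)) x) = 0 := by
    have h1 : HasFDerivAt (fun y => G (e y)) (A.comp (fderiv ℝ (fun y => (e y : E)) x)) x :=
      HasFDerivAt.comp (g := G) x hA hd
    have h2 : (fun y => G (e y)) = fun _ => c := funext fun y => hK _ (e y).2
    rw [h2] at h1
    exact h1.unique (hasFDerivAt_const c x)
  -- The image lies in the kernel because `G` is constant on `K`; both have dimension `d`.
  refine Submodule.eq_of_le_of_finrank_eq ?_ ?_
  · rintro _ ⟨v, rfl⟩
    exact congrArg (fun l => l v) hcomp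
  · rw [LinearMap.finrank_range_of_inj (he.injective_fderiv x hx), finrank_euclideanSpace_fin]
    have h1 := LinearMap.finrank_range_add_finrank_ker (A : E →ₗ[ℝ] H)
    rw [LinearMap.range_eq_top.2 hsurj, finrank_top, hdim] at h1
    exact (Nat.add_left_cancel h1).symm

/-- A point of a level set is singular for `h` iff the derivative of `h` has small rank on the
kernel of the derivative of the defining map. -/
theorem mem_singularSet_iff [FiniteDimensional ℝ E] [FiniteDimensional ℝ H] {d : ℕ} {K : Set E}
    (hsub : IsSmoothSubmanifold d K) {G : E → H} {c : H} {A : E →L[ℝ] H} (p : K)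
    (hA : HasFDerivAt G A p) (hK : ∀ z ∈ K, G z = c) (hsurj : Function.Surjective A)
    (hdim : Module.finrank ℝ E = Module.finrank ℝ H + d) {g : E → F} {B : E →L[ℝ] F}
    (hB : HasFDerivAt g B p) :
    p ∈ singularSet d (fun z : K => g z) ↔
      Module.finrank ℝ ((LinearMap.ker (A : E →ₗ[ℝ] H)).map (B : E →ₗ[ℝ] F)) <
        min d (Module.finrank ℝ F) := by
  -- The image of the differential is the same for every parametrization, so the existential choice
  -- of chart in `singularSet` is harmless.
  have key : ∀ e : OpenPartialHomeomorph (EuclideanSpace ℝ (Fin d)) K, IsLocalParametrization e →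
      p ∈ e.target → LinearMap.range (fderiv ℝ (fun x => g (e x)) (e.symm p) :
        EuclideanSpace ℝ (Fin d) →ₗ[ℝ] F) =
        (LinearMap.ker (A : E →ₗ[ℝ] H)).map (B : E →ₗ[ℝ] F) := by
    intro e he hp
    have hx := e.map_target hp
    have hpe : e (e.symm p) = p := e.right_inv hp
    rw [← he.range_fderiv hx (by rwa [hpe]) hK hsurj hdim, ← LinearMap.range_comp]
    have hd := ((he.contDiffOn.contDiffAt (e.open_source.mem_nhds hx)).differentiableAt
      (by simp)).hasFDerivAt
    have h1 : HasFDerivAt (fun y => g (e y)) (B.comp (fderiv ℝ (fun y => (e y : E)) (e.symm p)))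
        (e.symm p) := HasFDerivAt.comp (g := g) _ (by rwa [hpe]) hd
    rw [h1.fderiv]
    rfl
  constructor
  · rintro ⟨e, he, hp, hr⟩
    rwa [key e he hp] at hr
  · intro h
    obtain ⟨e, he, hp⟩ := hsub p
    exact ⟨e, he, hp, by rwa [key e he hp]⟩

end LevelSets

/-! ### Hermitian duality for three vectors. -/

section HermitianLinearAlgebra

variable {E : Type*} [NormedAddCommGroup E] [InnerProductSpace ℂ E] [FiniteDimensional ℂ E]

/-- The inner products with linearly independent vectors can be prescribed. -/
theorem LinearIndependent.exists_inner_eq {ι : Type*} {w : ι → E} (hw : LinearIndependent ℂ w)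
    (c : ι → ℂ) : ∃ v, ∀ i, inner ℂ (w i) v = c i := by
  have : CompleteSpace E := FiniteDimensional.complete ℂ E
  obtain ⟨φ, hφ⟩ := LinearMap.exists_extend
    ((Module.Basis.span hw).constr ℂ fun i => conj (c i))
  refine ⟨(InnerProductSpace.toDual ℂ E).symm (LinearMap.toContinuousLinearMap φ), fun i => ?_⟩
  rw [← inner_conj_symm, InnerProductSpace.toDual_symm_apply]
  have h1 := LinearMap.congr_fun hφ (Module.Basis.span hw i)
  rw [Module.Basis.constr_basis] at h1
  have h2 : φ (w i) = conj (c i) := by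
    rw [← h1]
    simp [Module.Basis.span_apply]
  change conj (φ (w i)) = c i
  rw [h2, Complex.conj_conj]

variable {a b z : E}

theorem exists_inner_eq_and_re_inner_eq (h : LinearIndependent ℂ ![a, z]) (c : ℂ) (r : ℝ) :
    ∃ v, inner ℂ a v = c ∧ (inner ℂ z v).re = r := by
  obtain ⟨v, hv⟩ := h.exists_inner_eq ![c, (r : ℂ)]
  refine ⟨v, hv 0, ?_⟩
  have h1 : inner ℂ z v = (r : ℂ) := hv 1
  rw [h1, Complex.ofReal_re]

/-- The form `⟨b, ·⟩` is onto on the real subspace `⟨a, v⟩ = 0`, `re ⟨z, v⟩ = 0` iff `a`, `b`, `z`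
are linearly independent over `ℂ`. -/
theorem forall_exists_inner_eq_iff (h : LinearIndependent ℂ ![a, z]) :
    (∀ c : ℂ, ∃ v, (inner ℂ a v = 0 ∧ (inner ℂ z v).re = 0) ∧ inner ℂ b v = c) ↔
      LinearIndependent ℂ ![a, b, z] := by
  constructor
  · intro hs
    by_contra hdep
    obtain ⟨s, hs0, i, hi⟩ := Fintype.not_linearIndependent_iff.1 hdep
    rw [Fin.sum_univ_three] at hs0
    change s 0 • a + s 1 • b + s 2 • z = 0 at hs0
    have hrel : ∀ v, inner ℂ a v = 0 →
        conj (s 1) * inner ℂ b v + conj (s 2) * inner ℂ z v = 0 := by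
      intro v hv
      have := congrArg (fun x => inner ℂ x v) hs0
      simpa [inner_add_left, inner_smul_left, hv, mul_comm] using this
    have h1 : s 1 ≠ 0 := by
      intro h1
      rw [h1, zero_smul, add_zero] at hs0
      obtain ⟨h0, h2⟩ := LinearIndependent.pair_iff.1 h _ _ hs0
      fin_cases i <;> simp_all
    by_cases h2 : s 2 = 0
    · obtain ⟨v, ⟨hv, -⟩, hbv⟩ := hs 1
      have := hrel v hv
      rw [hbv, h2] at this
      simp [h1] at this
    -- This target value is chosen so that the dependence relation forces `⟨z, v⟩ = 1`,
    -- contradicting the vanishing of its real part.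
    · obtain ⟨v, ⟨hv, hzv⟩, hbv⟩ := hs (-(conj (s 2) / conj (s 1)))
      have h1' : conj (s 1) ≠ 0 := by simpa using h1
      have h2' : conj (s 2) ≠ 0 := by simpa using h2
      have h3 := hrel v hv
      rw [hbv] at h3
      have h4 : conj (s 2) * (inner ℂ z v - 1) = 0 := by
        rw [← h3]; field_simp; ring
      have h5 := sub_eq_zero.1 ((mul_eq_zero.1 h4).resolve_left h2')
      rw [h5] at hzv
      simp at hzv
  · intro hli c
    obtain ⟨v, hv⟩ := hli.exists_inner_eq ![0, c, 0]
    have hz : inner ℂ z v = 0 := hv 2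
    exact ⟨v, ⟨hv 0, by rw [hz, Complex.zero_re]⟩, hv 1⟩

end HermitianLinearAlgebra

/-! ### The link, its singular set and the choice of radius. -/

section Link

open Metric Filter Topology

variable {m : ℕ}

theorem fderiv_apply_eq_inner (f : EuclideanSpace ℂ (Fin m) → ℂ) (z v : EuclideanSpace ℂ (Fin m)) :
    fderiv ℂ f z v = inner ℂ (conjGrad f z) v := by
  rw [fderiv_apply_eq_sum, PiLp.inner_apply]
  rfl

theorem conjGrad_ne_zero {f : EuclideanSpace ℂ (Fin m) → ℂ} {z : EuclideanSpace ℂ (Fin m)}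
    (h : fderiv ℂ f z ≠ 0) : conjGrad f z ≠ 0 := by
  intro h0
  refine h (ContinuousLinearMap.ext fun v => ?_)
  rw [fderiv_apply_eq_inner, h0, inner_zero_left]
  rfl

/-- The derivative of `z ↦ (f z, ‖z‖ ^ 2)`. -/
noncomputable def linkDeriv (f : EuclideanSpace ℂ (Fin m) → ℂ) (z : EuclideanSpace ℂ (Fin m)) :
    EuclideanSpace ℂ (Fin m) →L[ℝ] ℂ × ℝ :=
  ((fderiv ℂ f z).restrictScalars ℝ).prod
    ((2 : ℝ) • Complex.reCLM.comp ((innerSL ℂ z).restrictScalars ℝ))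

theorem linkDeriv_apply (f : EuclideanSpace ℂ (Fin m) → ℂ) (z v : EuclideanSpace ℂ (Fin m)) :
    linkDeriv f z v = (inner ℂ (conjGrad f z) v, 2 * (inner ℂ z v).re) := by
  rw [← fderiv_apply_eq_inner]
  rfl

theorem hasFDerivAt_link {f : EuclideanSpace ℂ (Fin m) → ℂ} {z : EuclideanSpace ℂ (Fin m)}
    (hf : DifferentiableAt ℂ f z) :
    HasFDerivAt (fun z => (f z, ‖z‖ ^ 2)) (linkDeriv f z) z := by
  refine (hf.hasFDerivAt.restrictScalars ℝ).prodMk ?_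
  have h1 := (hasFDerivAt_id (𝕜 := ℝ) z).inner ℂ (hasFDerivAt_id z)
  have h2 := Complex.reCLM.hasFDerivAt.comp z h1
  convert! h2 using 1
  · funext w
    exact (inner_self_eq_norm_sq (𝕜 := ℂ) w).symm
  · ext v
    have : (inner ℂ v z).re = (inner ℂ z v).re := by
      rw [← inner_conj_symm, Complex.conj_re]
    simp [fderivInnerCLM_apply, this]
    ring

theorem linkDeriv_surjective {f : EuclideanSpace ℂ (Fin m) → ℂ} {z : EuclideanSpace ℂ (Fin m)}
    (h : LinearIndependent ℂ ![conjGrad f z, z]) : Function.Surjective (linkDeriv f z) := by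
  rintro ⟨c, r⟩
  obtain ⟨v, h1, h2⟩ := exists_inner_eq_and_re_inner_eq h c (r / 2)
  exact ⟨v, by rw [linkDeriv_apply, h1, h2]; congr 1; ring⟩

theorem finrank_eq_link {n : ℕ} (hn : 2 ≤ n) :
    Module.finrank ℝ (EuclideanSpace ℂ (Fin (n + 1))) =
      Module.finrank ℝ (ℂ × ℝ) + (2 * n - 1) := by
  rw [Module.finrank_prod, Complex.finrank_real_complex, Module.finrank_self,
    ← Module.finrank_mul_finrank ℝ ℂ, Complex.finrank_real_complex, finrank_euclideanSpace_fin]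
  omega

theorem mem_link_iff {f : EuclideanSpace ℂ (Fin m) → ℂ} {ε : ℝ} (hε : 0 < ε)
    {z : EuclideanSpace ℂ (Fin m)} : z ∈ link f ε ↔ (f z, ‖z‖ ^ 2) = ((0 : ℂ), ε ^ 2) := by
  rw [link, Set.mem_inter_iff, mem_sphere_zero_iff_norm, Prod.mk.injEq,
    sq_eq_sq₀ (norm_nonneg z) hε.le]
  rfl

theorem isSmoothSubmanifold_link {n : ℕ} (hn : 2 ≤ n) {W : Set (EuclideanSpace ℂ (Fin (n + 1)))}
    (hW : IsOpen W) {f : EuclideanSpace ℂ (Fin (n + 1)) → ℂ} (hf : DifferentiableOn ℂ f W)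
    {ε : ℝ} (hε : 0 < ε) (hKW : link f ε ⊆ W)
    (h : ∀ z ∈ link f ε, LinearIndependent ℂ ![conjGrad f z, z]) :
    IsSmoothSubmanifold (2 * n - 1) (link f ε) := by
  intro p
  refine exists_isLocalParametrization (G := fun z => (f z, ‖z‖ ^ 2)) (c := ((0 : ℂ), ε ^ 2)) p hW
    (hKW p.2) ?_ (fun z _ => mem_link_iff hε) ?_ (finrank_eq_link hn)
  · exact ((hf.contDiffOn_complex_of_finiteDimensional hW).restrict_scalars ℝ).prodMk
      (contDiff_norm_sq ℂ).contDiffOn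
  · rw [(hasFDerivAt_link (hf.differentiableAt (hW.mem_nhds (hKW p.2)))).fderiv]
    exact linkDeriv_surjective (h p p.2)

/-- Since `2 ≤ n`, the required rank is 2, the real dimension of `ℂ`. Singularity therefore says
that the image of the tangent space under `dg` is a proper subspace, which Hermitian duality
translates into dependence. -/
theorem mem_singularSet_link_iff {n : ℕ} (hn : 2 ≤ n) {W : Set (EuclideanSpace ℂ (Fin (n + 1)))}
    (hW : IsOpen W) {f : EuclideanSpace ℂ (Fin (n + 1)) → ℂ} (hf : DifferentiableOn ℂ f W)
    {ε : ℝ} (hε : 0 < ε) (hKW : link f ε ⊆ W)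
    (h : ∀ z ∈ link f ε, LinearIndependent ℂ ![conjGrad f z, z])
    {g : EuclideanSpace ℂ (Fin (n + 1)) → ℂ} (z₀ : link f ε) (hg : DifferentiableAt ℂ g z₀) :
    z₀ ∈ singularSet (2 * n - 1) (fun z : link f ε => g z) ↔
      ¬ LinearIndependent ℂ
        ![conjGrad f z₀, conjGrad g z₀, (z₀ : EuclideanSpace ℂ (Fin (n + 1)))] := by
  rw [mem_singularSet_iff (isSmoothSubmanifold_link hn hW hf hε hKW h) z₀
    (hasFDerivAt_link (hf.differentiableAt (hW.mem_nhds (hKW z₀.2))))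
    (fun z hz => (mem_link_iff hε).1 hz) (linkDeriv_surjective (h z₀ z₀.2)) (finrank_eq_link hn)
    (hg.hasFDerivAt.restrictScalars ℝ), ← forall_exists_inner_eq_iff (h z₀ z₀.2),
    min_eq_right (by rw [Complex.finrank_real_complex]; omega)]
  set S := (LinearMap.ker (linkDeriv f z₀ : EuclideanSpace ℂ (Fin (n + 1)) →ₗ[ℝ] ℂ × ℝ)).map
    (((fderiv ℂ g z₀).restrictScalars ℝ : EuclideanSpace ℂ (Fin (n + 1)) →L[ℝ] ℂ) :
      EuclideanSpace ℂ (Fin (n + 1)) →ₗ[ℝ] ℂ) with hS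
  have hmem : ∀ c : ℂ, c ∈ S ↔ ∃ v, (inner ℂ (conjGrad f z₀) v = 0 ∧
      (inner ℂ (z₀ : EuclideanSpace ℂ (Fin (n + 1))) v).re = 0) ∧
        inner ℂ (conjGrad g z₀) v = c := by
    intro c
    rw [hS, Submodule.mem_map]
    refine exists_congr fun v => and_congr ?_ ?_
    · rw [LinearMap.mem_ker]
      change linkDeriv f z₀ v = 0 ↔ _
      rw [linkDeriv_apply, Prod.mk_eq_zero, mul_eq_zero, or_iff_right two_ne_zero]
    · rw [← fderiv_apply_eq_inner]; rfl
  have htop : S = ⊤ ↔ ∀ c : ℂ, ∃ v, (inner ℂ (conjGrad f z₀) v = 0 ∧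
      (inner ℂ (z₀ : EuclideanSpace ℂ (Fin (n + 1))) v).re = 0) ∧
        inner ℂ (conjGrad g z₀) v = c := by
    rw [Submodule.eq_top_iff']
    exact forall_congr' hmem
  rw [← htop]
  constructor
  · intro hlt heq
    rw [heq, finrank_top] at hlt
    exact lt_irrefl _ hlt
  · exact fun hne => Submodule.finrank_lt hne

theorem det_eq_zero_iff_not_linearIndependent (v : Fin 3 → EuclideanSpace ℂ (Fin 3)) :
    (Matrix.of fun i j => v j i).det = 0 ↔ ¬ LinearIndependent ℂ v := by
  have h : LinearIndependent ℂ v ↔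
      LinearIndependent ℂ (Matrix.of fun i j => v j i : Matrix (Fin 3) (Fin 3) ℂ).col :=
    ((PiLp.continuousLinearEquiv 2 ℂ fun _ : Fin 3 => ℂ).toLinearEquiv.toLinearMap
      |>.linearIndependent_iff (LinearEquiv.ker _)).symm
  rw [h, Matrix.linearIndependent_cols_iff_isUnit, Matrix.isUnit_iff_isUnit_det, isUnit_iff_ne_zero,
    not_not]

/-- Small spheres meet the zero set of a holomorphic function with an isolated critical point
transversally. -/
theorem exists_radius {W : Set (EuclideanSpace ℂ (Fin m))} (hW : IsOpen W) (h0W : 0 ∈ W)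
    {f : EuclideanSpace ℂ (Fin m) → ℂ} (hf : DifferentiableOn ℂ f W)
    (hcrit : HasIsolatedCriticalPoint f 0) :
    ∃ ε₀ : ℝ, 0 < ε₀ ∧ closedBall 0 ε₀ ⊆ W ∧ ∀ ε : ℝ, 0 < ε → ε < ε₀ →
      ∀ z ∈ link f ε, LinearIndependent ℂ ![conjGrad f z, z] := by
  have hWn : ∀ᶠ z in 𝓝 (0 : EuclideanSpace ℂ (Fin m)), z ∈ W := hW.mem_nhds h0W
  have hHol : HolomorphicNearZero f :=
    hWn.mono fun z hz => hf.differentiableAt (hW.mem_nhds hz)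
  obtain ⟨r, hr, hball⟩ := Metric.mem_nhds_iff.1
    (hWn.and ((eventually_nhdsWithin_iff.1 hcrit.2).and (eventually_ne_smul_conjGrad hHol)))
  refine ⟨r / 2, half_pos hr,
    fun z hz => (hball (closedBall_subset_ball (half_lt_self hr) hz)).1, fun ε hε hεr z hz => ?_⟩
  have hzn : ‖z‖ = ε := mem_sphere_zero_iff_norm.1 hz.2
  have hz0 : z ≠ 0 := norm_pos_iff.1 (hzn ▸ hε)
  obtain ⟨-, hc, ht⟩ := hball (mem_ball_zero_iff.2 (by linarith))
  -- The isolated critical point makes the gradient nonzero, so dependence could only mean that `z`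
  -- is a multiple of it.
  rw [LinearIndependent.pair_iff' (conjGrad_ne_zero (hc hz0))]
  exact fun μ h => ht hz.1 hz0 μ h.symm

end Link

theorem lemma2p3 (n : ℕ) (hn : 2 ≤ n)
    (W : Set (EuclideanSpace ℂ (Fin (n + 1)))) (hW : IsOpen W) (h0W : 0 ∈ W)
    (f : EuclideanSpace ℂ (Fin (n + 1)) → ℂ) (hf : DifferentiableOn ℂ f W) (hf0 : f 0 = 0)
    (hcrit : HasIsolatedCriticalPoint f 0) :
    ∃ ε₀ : ℝ, 0 < ε₀ ∧ Metric.closedBall 0 ε₀ ⊆ W ∧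
      ∀ ε : ℝ, 0 < ε → ε < ε₀ →
        IsSmoothSubmanifold (2 * n - 1) (link f ε) ∧
        ∀ U : Set (EuclideanSpace ℂ (Fin (n + 1))), IsOpen U → 0 ∈ U → link f ε ⊆ U →
        ∀ g : EuclideanSpace ℂ (Fin (n + 1)) → ℂ, DifferentiableOn ℂ g U →
          (∀ z₀ : link f ε,
            z₀ ∈ singularSet (2 * n - 1) (fun z : link f ε => g z) ↔
              ¬ LinearIndependent ℂ
                ![conjGrad f z₀, conjGrad g z₀, (z₀ : EuclideanSpace ℂ (Fin (n + 1)))]) ∧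
          (∀ h2 : n = 2,
            singularSet (2 * n - 1) (fun z : link f ε => g z) =
              {z : link f ε |
                (Matrix.of fun i j : Fin 3 =>
                  (![conjGrad f z, conjGrad g z, (z : EuclideanSpace ℂ (Fin (n + 1)))] j)
                    (Fin.cast (by omega) i)).det = 0}) := by
  obtain ⟨ε₀, hε₀, hball, hind⟩ := exists_radius hW h0W hf hcrit
  refine ⟨ε₀, hε₀, hball, fun ε hε hεε₀ => ?_⟩
  have hKW : link f ε ⊆ W := fun z hz =>
    hball (Metric.sphere_subset_closedBall.trans (Metric.closedBall_subset_closedBall hεε₀.le) hz.2)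
  have h := hind ε hε hεε₀
  refine ⟨isSmoothSubmanifold_link hn hW hf hε hKW h, fun U hU _ hKU g hg => ?_⟩
  have hiff := fun z₀ : link f ε => mem_singularSet_link_iff hn hW hf hε hKW h (g := g) z₀
    (hg.differentiableAt (hU.mem_nhds (hKU z₀.2)))
  refine ⟨hiff, ?_⟩
  rintro rfl
  ext z
  rw [hiff z, Set.mem_ofPred_eq, ← det_eq_zero_iff_not_linearIndependent]
  rfl
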